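/- **Setting.** Let $n\ge 1$, let $\|\cdot\|$ be the Euclidean norm on $\mathbb R^n$ and the operator norm it induces on matrices, and let $\lambda_{\min}$ denote the smallest eigenvalue of a symmetric matrix. Let $f:\mathbb R^n\to\mathbb R$ and $x_0\in\mathbb R^n$ satisfy: * (AS.1) $f$ is twice continuously differentiable; * (AS.2) $f(x)\ge f_{\rm low}$ for all $x$; * (AS.3) there are $L_0\ge0$, $L_1\ge0$, $\delta>0$ such that $\|\nabla^2 f(y)-\nabla^2 f(x)\|\le (L_0+L_1\|\nabla f(x)\|)\,\|x-y\|$ whenever $\|x-y\|\le\delta$; * (AS.4) there is $\kappa_B\ge0$ such that $\max(0,-\lambda_{\min}(\nabla^2 f(x)))\le\kappa_B$ for all $x$ with $f(x)\le f(x_0)$. **Algorithm SOAN2CLS.** Parameters: $\epsilon_1,\epsilon_2\in(0,1]$, $0<\sigma_{\min}\le\sigma_0$, $\kappa_C\ge1$, $\kappa_\theta\ge0$, $0<\theta\le1$, $\vartheta\ge1$, $0<\gamma_1<1<\gamma_2\le\gamma_3$, $0<\eta_1\le\eta_2<1$. Put $$\kappa_{\rm slow}=(1+\kappa_\theta+\kappa_C)+\sqrt{(1+\kappa_\theta+\kappa_C)^2+\vartheta},\qquad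 \kappa_{\rm upnewt}=3(1-\eta_2)+1+\kappa_C+\kappa_\theta .$$ At iteration $k\ge0$, with $g_k=\nabla f(x_k)$ and $H_k=\nabla^2 f(x_k)$: 1. Terminate if $\|g_k\|\le\epsilon_1$ and $\lambda_{\min}(H_k)\ge-\epsilon_2$. 2. If $\|g_k\|>\epsilon_1$ (first-order step), a procedure returns some $\mu_k\ge0$ and $s_k$ such that: * if $\mu_k\le\kappa_C\sqrt{\sigma_k}\|g_k\|$ (Newton step), then with $r_k=(H_k+(\sqrt{\sigma_k}\|g_k\|+\mu_k)I)s_k+g_k$ one has $s_k^\top(H_k+\mu_kI)s_k\ge0$, $\|r_k\|\le\kappa_\theta\min(\sqrt{\sigma_k}\|g_k\|\|s_k\|,\|g_k\|)$ and $r_k^\top s_k=0$; in this case put $\kappa_k=\kappa_{\rm upnewt}$; * otherwise $s_k=\frac{\theta\kappa_C}{\sqrt{\sigma_k}}u_k$ with $g_k^\top u_k\le0$, $\|u_k\|=1$, $u_k^\top H_ku_k\le-\theta\mu_k$, $u_k^\top H_k^2u_k\le\mu_k^2/\theta^2$; in this case put $\kappa_k=\frac32\kappa_C^2\theta^2(1-\eta_2)+1+\kappa_C\mu_k/\sqrt{\sigma_k}$.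 If $\|g_k\|\le\epsilon_1$ (second-order step), $s_k=u_k/\sqrt{\sigma_k}$ with $g_k^\top u_k\le0$, $\|u_k\|=1$, $H_ku_k=\lambda_{\min}(H_k)u_k$; in this case put $\kappa_{k,\rm hess}=\frac{3(1-\eta_2)|\lambda_{\min}(H_k)|}{2\sqrt{\sigma_{\min}}}+1+\frac{|\lambda_{\min}(H_k)|}{\sqrt{\sigma_k}}$. 3. Let $\rho_k=\dfrac{f(x_k)-f(x_k+s_k)}{-(g_k^\top s_k+\frac12s_k^\top H_ks_k)}$. A first-order step is rejected if (i) it is a Newton step with $\|\nabla f(x_k+s_k)\|>\frac12\|g_k\|$ and $\|s_k\|<1/(\sqrt{\sigma_k}\,\kappa_{\rm slow})$, or (ii) $\rho_k<\eta_1$, or (iii) $\|\nabla f(x_k+s_k)\|>\kappa_k\|g_k\|/\epsilon_1$. A second-order step is rejected if $\rho_k<\eta_1$ or $\|\nabla f(x_k+s_k)\|>\kappa_{k,\rm hess}$. 4. If the step is not rejected, $x_{k+1}=x_k+s_k$; otherwise $x_{k+1}=x_k$. 5. $\sigma_{k+1}\in[\max(\sigma_{\min},\gamma_1\sigma_k),\sigma_k]$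 if the step is not rejected and $\rho_k\ge\eta_2$; $\sigma_{k+1}\in[\sigma_k,\gamma_2\sigma_k]$ if the step is not rejected and $\rho_k<\eta_2$; $\sigma_{k+1}\in[\gamma_2\sigma_k,\gamma_3\sigma_k]$ if the step is rejected. Iteration $k$ is *successful* if $x_{k+1}=x_k+s_k$. **Constants.** Put $\Delta=f(x_0)-f_{\rm low}$ and $$\kappa_{\rm max1}=\gamma_3\max\Big(\sigma_0,\tfrac{\kappa_C^2\theta^2}{\delta^2},\tfrac1{\delta^2},\tfrac{L_0+L_1}{3(1-\eta_2)},\tfrac{L_0+L_1}{\vartheta}\Big),\qquad \kappa_{\rm max2}=\gamma_3\max\Big(\tfrac1{\delta^2},\tfrac{(L_0+L_1)^2}{9(1-\eta_2)^2}\Big),$$ $$\kappa_{\rm upncurv}=\tfrac32\theta^2\kappa_C^2(1-\eta_2)+1+\tfrac{\kappa_C\kappa_B}{\theta\sqrt{\sigma_{\min}}},\qquad \kappa_{\rm gpi}=\max\Big(\|\nabla f(x_0)\|,\ \tfrac{3(1-\eta_2)\kappa_B}{2\sqrt{\sigma_{\min}}}+1+\tfrac{\kappa_B}{\sqrt{\sigma_{\min}}}\Big),$$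 $$\kappa_{\rm ncurvhess}=\tfrac{2\Delta\sqrt{\kappa_{\rm max1}}}{\eta_1\kappa_C^3\theta^3}\max\Big(1,\tfrac{\sqrt{\kappa_{\rm max2}}}{\sqrt{\kappa_{\rm max1}}}\Big),\quad \kappa_{\rm decrhess}=\tfrac{\Delta\,\kappa_{\rm slow}^2\sqrt{\kappa_{\rm max1}}}{\eta_1}\max\Big(1,\tfrac{\sqrt{\kappa_{\rm max2}}}{\sqrt{\kappa_{\rm max1}}}\Big),\quad \kappa_{\rm so}=\tfrac{2\Delta\max(\kappa_{\rm max2},\kappa_{\rm max1})}{\eta_1},$$ $$\kappa_{\star,\rm hess}=\kappa_{\rm ncurvhess}\Big(1+\tfrac{\log\kappa_{\rm upncurv}}{\log2}\Big)+\kappa_{\rm decrhess}\Big(1+\tfrac{\log\kappa_{\rm upnewt}}{\log2}\Big)+\kappa_{\rm so}\Big(2+\tfrac{\log\kappa_{\rm gpi}}{\log2}\Big),\qquad \kappa_{\star,\log}=\tfrac{\kappa_{\rm ncurvhess}+\kappa_{\rm decrhess}+\kappa_{\rm so}}{\log2}.$$ **Theorem.** Every run of SOAN2CLS started at $x_0$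 terminates, that is, it produces an iterate $x_\epsilon$ with $\|\nabla f(x_\epsilon)\|\le\epsilon_1$ and $\lambda_{\min}(\nabla^2f(x_\epsilon))\ge-\epsilon_2$, after at most $$N_{\mathcal S}=\kappa_{\star,\rm hess}\big(\epsilon_1^{-3/2}+\epsilon_2^{-3}\big)+\kappa_{\star,\log}|\log\epsilon_1|\big(\epsilon_1^{-3/2}+\epsilon_2^{-3}\big)+\frac{|\log\epsilon_1|+\log\kappa_{\rm gpi}}{\log2}+1$$ successful iterations and at most $$\Big(1+\frac{|\log\gamma_1|}{\log\gamma_2}\Big)N_{\mathcal S}+\frac1{\log\gamma_2}\log\Big(\max\Big(\frac{\kappa_{\rm max1}\epsilon_1^{-1}}{\sigma_0},\frac{\kappa_{\rm max2}\epsilon_2^{-2}}{\sigma_0}\Big)\Big)$$ iterations in total. -/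

import Mathlib

open scoped RealInnerProductSpace

noncomputable section

namespace SOAN2CLS

/-- The space `ℝⁿ` with the Euclidean norm. -/
abbrev E (n : ℕ) : Type := EuclideanSpace ℝ (Fin n)

/-- The Hessian of `f` at `x`, as a continuous linear operator on `ℝⁿ`; its norm is the operator
norm subordinate to the Euclidean norm. -/
def hess {n : ℕ} (f : E n → ℝ) (x : E n) : E n →L[ℝ] E n :=
  fderiv ℝ (gradient f) x

/-- The smallest real eigenvalue (used only for symmetric operators, with `n ≥ 1`). -/
def lambdaMin {n : ℕ} (A : E n →L[ℝ] E n) : ℝ :=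
  sInf {c : ℝ | Module.End.HasEigenvalue (A : E n →ₗ[ℝ] E n) c}

/-! ### Assumptions on the objective function -/

/-- Local smoothness of the Hessian with constants `L₀`, `L₁` and radius `δ`. -/
def LocallySmoothHessian {n : ℕ} (f : E n → ℝ) (L₀ L₁ δ : ℝ) : Prop :=
  0 ≤ L₀ ∧ 0 ≤ L₁ ∧ 0 < δ ∧
    ∀ x y : E n, ‖x - y‖ ≤ δ →
      ‖hess f y - hess f x‖ ≤ (L₀ + L₁ * ‖gradient f x‖) * ‖x - y‖

/-- The negative curvature of `f` is bounded by `κB` on the level set of `x₀`. -/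
def NegCurvatureBounded {n : ℕ} (f : E n → ℝ) (x₀ : E n) (κB : ℝ) : Prop :=
  0 ≤ κB ∧ ∀ x : E n, f x ≤ f x₀ → max 0 (-lambdaMin (hess f x)) ≤ κB

/-! ### The algorithm -/

/-- The parameters of the algorithm, with their admissible ranges. -/
structure Params where
  σ₀ : ℝ
  σmin : ℝ
  κC : ℝ
  κθ : ℝ
  θ : ℝ
  vartheta : ℝ
  γ₁ : ℝ
  γ₂ : ℝ
  γ₃ : ℝ
  η₁ : ℝ
  η₂ : ℝ
  ε₁ : ℝ
  ε₂ : ℝ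
  σmin_pos : 0 < σmin
  σmin_le : σmin ≤ σ₀
  one_le_κC : 1 ≤ κC
  κθ_nonneg : 0 ≤ κθ
  θ_pos : 0 < θ
  θ_le_one : θ ≤ 1
  one_le_vartheta : 1 ≤ vartheta
  γ₁_pos : 0 < γ₁
  γ₁_lt_one : γ₁ < 1
  one_lt_γ₂ : 1 < γ₂
  γ₂_le_γ₃ : γ₂ ≤ γ₃
  η₁_pos : 0 < η₁
  η₁_le_η₂ : η₁ ≤ η₂
  η₂_lt_one : η₂ < 1
  ε₁_pos : 0 < ε₁
  ε₁_le_one : ε₁ ≤ 1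
  ε₂_pos : 0 < ε₂
  ε₂_le_one : ε₂ ≤ 1

def kappaSlow (P : Params) : ℝ :=
  (1 + P.κθ + P.κC) + Real.sqrt ((1 + P.κθ + P.κC) ^ 2 + P.vartheta)

def kappaUpNewt (P : Params) : ℝ :=
  3 * (1 - P.η₂) + 1 + P.κC + P.κθ

/-- The termination test at the point `x`. -/
def Terminated {n : ℕ} (P : Params) (f : E n → ℝ) (x : E n) : Prop :=
  ‖gradient f x‖ ≤ P.ε₁ ∧ -P.ε₂ ≤ lambdaMin (hess f x)

/-- The trial step is a Newton step (otherwise it is a negative-curvature step). -/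
def IsNewton {n : ℕ} (P : Params) (g : E n) (σ μ : ℝ) : Prop :=
  μ ≤ P.κC * Real.sqrt σ * ‖g‖

/-- The residual of the doubly regularized Newton system at `s`. -/
def residual {n : ℕ} (g : E n) (H : E n →L[ℝ] E n) (σ μ : ℝ) (s : E n) : E n :=
  H s + (Real.sqrt σ * ‖g‖ + μ) • s + g

/-- The conditions that define an admissible output `(s, μ)` of the first-order step computation
for the gradient `g`, the Hessian `H` and the regularization parameter `σ`. -/
def StepComp {n : ℕ} (P : Params) (g : E n) (H : E n →L[ℝ] E n) (σ : ℝ) (s : E n) (μ : ℝ) :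
    Prop :=
  0 ≤ μ ∧
  (IsNewton P g σ μ →
    0 ≤ ⟪s, H s + μ • s⟫ ∧
    ‖residual g H σ μ s‖ ≤ P.κθ * min (Real.sqrt σ * ‖g‖ * ‖s‖) ‖g‖ ∧
    ⟪residual g H σ μ s, s⟫ = 0) ∧
  (¬ IsNewton P g σ μ →
    ∃ u : E n, s = (P.θ * P.κC / Real.sqrt σ) • u ∧
      ⟪g, u⟫ ≤ 0 ∧ ‖u‖ = 1 ∧
      ⟪u, H u⟫ ≤ -P.θ * μ ∧
      ⟪u, H (H u)⟫ ≤ μ ^ 2 / P.θ ^ 2)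

/-- The second-order step: a multiple of a unit eigenvector for the smallest eigenvalue. -/
def SecondOrderStep {n : ℕ} (g : E n) (H : E n →L[ℝ] E n) (σ : ℝ) (s : E n) : Prop :=
  ∃ u : E n, s = (1 / Real.sqrt σ) • u ∧
    ⟪g, u⟫ ≤ 0 ∧ ‖u‖ = 1 ∧ H u = lambdaMin H • u

/-- The step `s` (and the regularization `μ`, when a first-order step is used) is admissible at
the iterate `x`. -/
def TrialStep {n : ℕ} (P : Params) (f : E n → ℝ) (x : E n) (σ : ℝ) (s : E n) (μ : ℝ) : Prop :=
  (P.ε₁ < ‖gradient f x‖ → StepComp P (gradient f x) (hess f x) σ s μ) ∧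
  (‖gradient f x‖ ≤ P.ε₁ → SecondOrderStep (gradient f x) (hess f x) σ s)

/-- The acceptance ratio: actual decrease over the decrease of the quadratic Taylor model. -/
def ratio {n : ℕ} (f : E n → ℝ) (x s : E n) : ℝ :=
  (f x - f (x + s)) / (-(⟪gradient f x, s⟫ + 1 / 2 * ⟪s, hess f x s⟫))

/-- The factor in the gradient test of first-order steps. -/
def kappaFO {n : ℕ} (P : Params) (g : E n) (σ μ : ℝ) : ℝ :=
  open Classical in
  if IsNewton P g σ μ then kappaUpNewt P
  else 3 / 2 * P.κC ^ 2 * P.θ ^ 2 * (1 - P.η₂) + 1 + P.κC * μ / Real.sqrt σ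

/-- The bound in the gradient test of second-order steps. -/
def kappaHess {n : ℕ} (P : Params) (H : E n →L[ℝ] E n) (σ : ℝ) : ℝ :=
  3 * (1 - P.η₂) * |lambdaMin H| / (2 * Real.sqrt P.σmin) + 1 + |lambdaMin H| / Real.sqrt σ

/-- A first-order step is rejected: either a Newton step is short and does not halve the
gradient, or the acceptance ratio is too small, or the new gradient is too large. -/
def FirstOrderRejected {n : ℕ} (P : Params) (f : E n → ℝ) (x : E n) (σ : ℝ) (s : E n) (μ : ℝ) :
    Prop :=
  (IsNewton P (gradient f x) σ μ ∧
    ‖gradient f x‖ / 2 < ‖gradient f (x + s)‖ ∧ ‖s‖ < 1 / (Real.sqrt σ * kappaSlow P)) ∨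
  ratio f x s < P.η₁ ∨
  kappaFO P (gradient f x) σ μ * (‖gradient f x‖ / P.ε₁) < ‖gradient f (x + s)‖

/-- A second-order step is rejected. -/
def SecondOrderRejected {n : ℕ} (P : Params) (f : E n → ℝ) (x : E n) (σ : ℝ) (s : E n) : Prop :=
  ratio f x s < P.η₁ ∨ kappaHess P (hess f x) σ < ‖gradient f (x + s)‖

/-- The final value of the rejection flag of an iteration. -/
def Rejected {n : ℕ} (P : Params) (f : E n → ℝ) (x : E n) (σ : ℝ) (s : E n) (μ : ℝ) : Prop :=
  (P.ε₁ < ‖gradient f x‖ ∧ FirstOrderRejected P f x σ s μ) ∨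
  (‖gradient f x‖ ≤ P.ε₁ ∧ SecondOrderRejected P f x σ s)

/-- The sequences of iterates `x k`, steps `s k` and parameters `μ k`, `σ k` are generated by the
algorithm. Iteration `k` is performed only if the termination test fails at `x 0, …, x k`; nothing
is required of the sequences beyond termination. -/
structure IsRun {n : ℕ} (P : Params) (f : E n → ℝ) (x s : ℕ → E n) (μ σ : ℕ → ℝ) : Prop where
  init : σ 0 = P.σ₀
  trial : ∀ k, (∀ j ≤ k, ¬ Terminated P f (x j)) → TrialStep P f (x k) (σ k) (s k) (μ k)
  accept : ∀ k, (∀ j ≤ k, ¬ Terminated P f (x j)) →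
    ¬ Rejected P f (x k) (σ k) (s k) (μ k) → x (k + 1) = x k + s k
  reject : ∀ k, (∀ j ≤ k, ¬ Terminated P f (x j)) →
    Rejected P f (x k) (σ k) (s k) (μ k) → x (k + 1) = x k
  sigma_verySuccessful : ∀ k, (∀ j ≤ k, ¬ Terminated P f (x j)) →
    ¬ Rejected P f (x k) (σ k) (s k) (μ k) → P.η₂ ≤ ratio f (x k) (s k) →
      σ (k + 1) ∈ Set.Icc (max P.σmin (P.γ₁ * σ k)) (σ k)
  sigma_successful : ∀ k, (∀ j ≤ k, ¬ Terminated P f (x j)) →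
    ¬ Rejected P f (x k) (σ k) (s k) (μ k) → ratio f (x k) (s k) < P.η₂ →
      σ (k + 1) ∈ Set.Icc (σ k) (P.γ₂ * σ k)
  sigma_unsuccessful : ∀ k, (∀ j ≤ k, ¬ Terminated P f (x j)) →
    Rejected P f (x k) (σ k) (s k) (μ k) →
      σ (k + 1) ∈ Set.Icc (P.γ₂ * σ k) (P.γ₃ * σ k)

/-- The successful iterations among the first `K` iterations. -/
def successful {n : ℕ} (x s : ℕ → E n) (K : ℕ) : Set ℕ :=
  {k | k < K ∧ x (k + 1) = x k + s k}

/-! ### The constants of the complexity bound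

`Δ` stands for the gap between `f x₀` and the lower bound on `f`, and `G` for the norm of the
initial gradient. -/

def kappaMax1 (P : Params) (L₀ L₁ δ : ℝ) : ℝ :=
  P.γ₃ * max P.σ₀ (max (P.κC ^ 2 * P.θ ^ 2 / δ ^ 2) (max (1 / δ ^ 2)
    (max ((L₀ + L₁) / (3 * (1 - P.η₂))) ((L₀ + L₁) / P.vartheta))))

def kappaMax2 (P : Params) (L₀ L₁ δ : ℝ) : ℝ :=
  P.γ₃ * max (1 / δ ^ 2) ((L₀ + L₁) ^ 2 / (9 * (1 - P.η₂) ^ 2))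

def kappaUpNcurv (P : Params) (κB : ℝ) : ℝ :=
  3 / 2 * P.θ ^ 2 * P.κC ^ 2 * (1 - P.η₂) + 1 + P.κC * κB / (P.θ * Real.sqrt P.σmin)

def kappaGpi (P : Params) (κB G : ℝ) : ℝ :=
  max G (3 * (1 - P.η₂) * κB / (2 * Real.sqrt P.σmin) + 1 + κB / Real.sqrt P.σmin)

def kappaNcurv (P : Params) (L₀ L₁ δ Δ : ℝ) : ℝ :=
  2 * Δ * Real.sqrt (kappaMax1 P L₀ L₁ δ) / (P.η₁ * P.κC ^ 3 * P.θ ^ 3)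

def kappaDecr (P : Params) (L₀ L₁ δ Δ : ℝ) : ℝ :=
  Δ * kappaSlow P ^ 2 * Real.sqrt (kappaMax1 P L₀ L₁ δ) / P.η₁

def kappaNcurvHess (P : Params) (L₀ L₁ δ Δ : ℝ) : ℝ :=
  kappaNcurv P L₀ L₁ δ Δ *
    max 1 (Real.sqrt (kappaMax2 P L₀ L₁ δ) / Real.sqrt (kappaMax1 P L₀ L₁ δ))

def kappaDecrHess (P : Params) (L₀ L₁ δ Δ : ℝ) : ℝ :=
  kappaDecr P L₀ L₁ δ Δ *
    max 1 (Real.sqrt (kappaMax2 P L₀ L₁ δ) / Real.sqrt (kappaMax1 P L₀ L₁ δ))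

def kappaSo (P : Params) (L₀ L₁ δ Δ : ℝ) : ℝ :=
  2 * Δ * max (kappaMax2 P L₀ L₁ δ) (kappaMax1 P L₀ L₁ δ) / P.η₁

def kappaStarHess (P : Params) (L₀ L₁ δ κB Δ G : ℝ) : ℝ :=
  kappaNcurvHess P L₀ L₁ δ Δ * (1 + Real.log (kappaUpNcurv P κB) / Real.log 2) +
  kappaDecrHess P L₀ L₁ δ Δ * (1 + Real.log (kappaUpNewt P) / Real.log 2) +
  kappaSo P L₀ L₁ δ Δ * (2 + Real.log (kappaGpi P κB G) / Real.log 2)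

def kappaStarLog (P : Params) (L₀ L₁ δ Δ : ℝ) : ℝ :=
  (kappaNcurvHess P L₀ L₁ δ Δ + kappaDecrHess P L₀ L₁ δ Δ + kappaSo P L₀ L₁ δ Δ) / Real.log 2

/-- The bound on the number of successful iterations. -/
def successBound (P : Params) (L₀ L₁ δ κB Δ G : ℝ) : ℝ :=
  kappaStarHess P L₀ L₁ δ κB Δ G * (P.ε₁ ^ (-(3 / 2) : ℝ) + P.ε₂ ^ (-3 : ℝ)) +
  kappaStarLog P L₀ L₁ δ Δ * |Real.log P.ε₁| * (P.ε₁ ^ (-(3 / 2) : ℝ) + P.ε₂ ^ (-3 : ℝ)) +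
  (|Real.log P.ε₁| + Real.log (kappaGpi P κB G)) / Real.log 2 + 1

/-- The bound on the total number of iterations. -/
def iterationBound (P : Params) (L₀ L₁ δ κB Δ G : ℝ) : ℝ :=
  (1 + |Real.log P.γ₁| / Real.log P.γ₂) * successBound P L₀ L₁ δ κB Δ G +
  1 / Real.log P.γ₂ *
    Real.log (max (kappaMax1 P L₀ L₁ δ * P.ε₁⁻¹ / P.σ₀)
      (kappaMax2 P L₀ L₁ δ * (P.ε₂ ^ 2)⁻¹ / P.σ₀))

end SOAN2CLS

end

/-!
The proof charges every successful iteration either to a decrease of `f` or to a halving of the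
gradient.

*Regularization stays bounded.* Taylor's theorem with the local Lipschitz constant
`L = L₀ + L₁ ‖∇f(x)‖` of the Hessian (`norm_gradient_sub_le`, `abs_taylor_sub_le`) shows that a step
is accepted, with ratio at least `η₂`, once `σ ε₁` (for first-order steps) or `σ ε₂²` (for
second-order steps) exceeds a threshold. For first-order steps `‖∇f(x)‖ > ε₁` turns `L` into a
multiple of `‖∇f(x)‖ / ε₁`, so the growth of the Lipschitz constant with the gradient is harmless.
Since `σ` grows by at most `γ₃` at a time and not at all at very successful steps, every `σ k` is at
most `regBound = max (κ_max1 / ε₁) (κ_max2 / ε₂²)` (`IsRun.sigma_mem`).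

*Progress.* With `σ` bounded, an accepted negative-curvature step, a Newton step that is not short,
and a second-order step each decrease `f` by at least the inverse of `weightNcurv`,
`weightDecr` and `weightSo`. The only other accepted steps are Newton steps that halve the gradient.
The logarithmic potential `gradPotential` of the gradient falls by one at such a step, and the tests
on the new gradient bound its growth at all others. Hence
`1 + (change of the potential) ≤ progressRate * (decrease of f)` at every accepted step
(`progress_of_accepted`), and summation along the run bounds the number of successful iterations
(`IsRun.successful_le_progress`, `add_progressRate_mul_le_successBound`).

*All iterations.* A rejection multiplies `σ` by at least `γ₂` and a success by at least `γ₁`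
(`IsRun.le_log_sigma`), so the upper bound on `σ` bounds the number of rejections in terms of the
number of successes. As both bounds hold before termination, a run cannot go on forever.
-/

namespace SOAN2CLS

/-! ### Second-order calculus on `ℝⁿ` -/

theorem contDiff_gradient {n : ℕ} {f : E n → ℝ} (hf : ContDiff ℝ 2 f) :
    ContDiff ℝ 1 (gradient f) := by
  let e : (E n →L[ℝ] ℝ) →ₗ[ℝ] E n :=
    { toFun := (InnerProductSpace.toDual ℝ (E n)).symm
      map_add' := map_add _
      map_smul' := fun c x => by simp }
  exact (LinearMap.toContinuousLinearMap e).contDiff.comp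
    (hf.fderiv_right (m := 1) (by norm_num))

theorem hasFDerivAt_gradient {n : ℕ} {f : E n → ℝ} (hf : ContDiff ℝ 2 f) (x : E n) :
    HasFDerivAt (gradient f) (hess f x) x :=
  ((contDiff_gradient hf).differentiable one_ne_zero x).hasFDerivAt

/-- The Hessian operator represents the second derivative of `f`; its symmetry follows from this. -/
theorem inner_hess {n : ℕ} {f : E n → ℝ} (hf : ContDiff ℝ 2 f) (x v w : E n) :
    ⟪hess f x v, w⟫ = fderiv ℝ (fderiv ℝ f) x v w := by
  have h1 : HasFDerivAt (fun y => ⟪gradient f y, w⟫)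
      ((innerSL ℝ w).comp (hess f x)) x := by
    have := (innerSL ℝ w).hasFDerivAt.comp x (hasFDerivAt_gradient hf x)
    refine this.congr_of_eventuallyEq (Filter.Eventually.of_forall fun y => ?_)
    simp
  have h2 : HasFDerivAt (fun y => ⟪gradient f y, w⟫)
      ((ContinuousLinearMap.apply ℝ ℝ w).comp (fderiv ℝ (fderiv ℝ f) x)) x := by
    have hd : HasFDerivAt (fderiv ℝ f) (fderiv ℝ (fderiv ℝ f) x) x :=
      (((hf.fderiv_right (m := 1) (by norm_num)).differentiable one_ne_zero) x).hasFDerivAt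
    have := (ContinuousLinearMap.apply ℝ ℝ w).hasFDerivAt.comp x hd
    refine this.congr_of_eventuallyEq (Filter.Eventually.of_forall fun y => ?_)
    simp [inner_gradient_left]
  have := congrArg (fun A => A v) (h1.unique h2)
  simpa [real_inner_comm] using this

theorem inner_hess_comm {n : ℕ} {f : E n → ℝ} (hf : ContDiff ℝ 2 f) (x v w : E n) :
    ⟪hess f x v, w⟫ = ⟪v, hess f x w⟫ := by
  rw [real_inner_comm (hess f x w) v, inner_hess hf, inner_hess hf]
  exact (hf.contDiffAt.isSymmSndFDerivAt (by simp)) v w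

/-- The Rayleigh quotient of a symmetric operator is at least its smallest eigenvalue, because the
infimum of the quotient is itself an eigenvalue. -/
theorem lambdaMin_le_inner {n : ℕ} {A : E n →L[ℝ] E n} (hA : ∀ v w, ⟪A v, w⟫ = ⟪v, A w⟫)
    {u : E n} (hu : ‖u‖ = 1) : lambdaMin A ≤ ⟪u, A u⟫ := by
  have hu0 : u ≠ 0 := by rintro rfl; simp at hu
  have : Nontrivial (E n) := ⟨u, 0, hu0⟩
  have hsymm : (A : E n →ₗ[ℝ] E n).IsSymmetric := hA
  have hev := hsymm.hasEigenvalue_iInf_of_finiteDimensional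
  have h1 : lambdaMin A ≤ _ :=
    csInf_le (Module.End.finite_hasEigenvalue (A : E n →ₗ[ℝ] E n)).bddBelow hev
  refine h1.trans ?_
  have hb : BddBelow (Set.range fun y : { y : E n // y ≠ 0 } =>
      RCLike.re ⟪(A : E n →ₗ[ℝ] E n) y, (y : E n)⟫ / ‖(y : E n)‖ ^ 2) := by
    refine ⟨-‖A‖, ?_⟩
    rintro _ ⟨⟨y, hy⟩, rfl⟩
    have hy' : 0 < ‖y‖ := norm_pos_iff.mpr hy
    have h2 : |⟪A y, y⟫| ≤ ‖A‖ * ‖y‖ * ‖y‖ :=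
      (abs_real_inner_le_norm _ _).trans (by gcongr; exact A.le_opNorm y)
    have h3 := (abs_le.mp h2).1
    simp only [RCLike.re_to_real, ContinuousLinearMap.coe_coe]
    rw [le_div_iff₀ (by positivity)]
    nlinarith
  refine (ciInf_le hb ⟨u, hu0⟩).trans (le_of_eq ?_)
  simp [hu, real_inner_comm]

/-- Taylor's theorem for the gradient: a Hessian that is Lipschitz along the segment from `x` to
`x + s` gives a quadratic error. -/
theorem norm_gradient_sub_le {n : ℕ} {f : E n → ℝ} (hf : ContDiff ℝ 2 f) {x s : E n} {L δ : ℝ}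
    (hL : ∀ y, ‖x - y‖ ≤ δ → ‖hess f y - hess f x‖ ≤ L * ‖x - y‖) (hs : ‖s‖ ≤ δ) :
    ‖gradient f (x + s) - gradient f x - hess f x s‖ ≤ L / 2 * ‖s‖ ^ 2 := by
  have hline (t : ℝ) : HasDerivAt (fun t : ℝ => x + t • s) s t := by
    simpa using ((hasDerivAt_id t).smul_const s).const_add x
  have hder (t : ℝ) : HasDerivAt
      (fun t : ℝ => gradient f (x + t • s) - gradient f x - t • hess f x s)
      (hess f (x + t • s) s - hess f x s) t := by
    have h1 := (hasFDerivAt_gradient hf (x + t • s)).comp_hasDerivAt t (hline t)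
    have h2 := (h1.sub_const (gradient f x)).sub ((hasDerivAt_id t).smul_const (hess f x s))
    exact h2.congr_deriv (by simp)
  have hB (t : ℝ) : HasDerivAt (fun t : ℝ => L / 2 * ‖s‖ ^ 2 * t ^ 2) (L * t * ‖s‖ ^ 2) t := by
    have := (hasDerivAt_pow 2 t).const_mul (L / 2 * ‖s‖ ^ 2)
    exact this.congr_deriv (by push_cast; ring)
  have key := image_norm_le_of_norm_deriv_right_le_deriv_boundary (a := (0 : ℝ)) (b := 1)
    (fun t _ => (hder t).continuousAt.continuousWithinAt)
    (fun t _ => (hder t).hasDerivWithinAt) (by simp) hB (fun t ht => ?_)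
    (Set.right_mem_Icc.mpr zero_le_one)
  · simpa using key
  · have hn : ‖x - (x + t • s)‖ = t * ‖s‖ := by
      simp [norm_smul, abs_of_nonneg ht.1]
    have hle : ‖x - (x + t • s)‖ ≤ δ := by
      rw [hn]; nlinarith [ht.1, ht.2, norm_nonneg s]
    calc ‖hess f (x + t • s) s - hess f x s‖
        = ‖(hess f (x + t • s) - hess f x) s‖ := by simp
      _ ≤ ‖hess f (x + t • s) - hess f x‖ * ‖s‖ := ContinuousLinearMap.le_opNorm _ _
      _ ≤ L * (t * ‖s‖) * ‖s‖ := by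
          gcongr; rw [← hn]; exact hL _ hle
      _ = L * t * ‖s‖ ^ 2 := by ring

/-- Taylor's theorem of order two: a Hessian that is Lipschitz along the segment from `x` to
`x + s` gives a cubic error. -/
theorem abs_taylor_sub_le {n : ℕ} {f : E n → ℝ} (hf : ContDiff ℝ 2 f) {x s : E n} {L δ : ℝ}
    (hL : ∀ y, ‖x - y‖ ≤ δ → ‖hess f y - hess f x‖ ≤ L * ‖x - y‖) (hs : ‖s‖ ≤ δ) :
    |f (x + s) - f x - (⟪gradient f x, s⟫ + 1 / 2 * ⟪s, hess f x s⟫)| ≤ L / 6 * ‖s‖ ^ 3 := by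
  have hline (t : ℝ) : HasDerivAt (fun t : ℝ => x + t • s) s t := by
    simpa using ((hasDerivAt_id t).smul_const s).const_add x
  have hder (t : ℝ) : HasDerivAt
      (fun t : ℝ => f (x + t • s) - f x - (t * ⟪gradient f x, s⟫ + t ^ 2 / 2 * ⟪s, hess f x s⟫))
      ⟪gradient f (x + t • s) - gradient f x - hess f x (t • s), s⟫ t := by
    have hfd : HasFDerivAt f (fderiv ℝ f (x + t • s)) (x + t • s) :=
      (hf.differentiable two_ne_zero _).hasFDerivAt
    have h1 := (hfd.comp_hasDerivAt t (hline t)).sub_const (f x)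
    have h2 := (hasDerivAt_id t).mul_const ⟪gradient f x, s⟫
    have h3 := ((hasDerivAt_pow 2 t).div_const 2).mul_const ⟪s, hess f x s⟫
    refine (h1.sub (h2.add h3)).congr_deriv ?_
    rw [inner_sub_left, inner_sub_left, inner_gradient_left, map_smul, inner_smul_left,
      real_inner_comm (hess f x s) s]
    simp
    ring
  have hB (t : ℝ) : HasDerivAt (fun t : ℝ => L / 6 * ‖s‖ ^ 3 * t ^ 3)
      (L / 2 * t ^ 2 * ‖s‖ ^ 3) t := by
    have := (hasDerivAt_pow 3 t).const_mul (L / 6 * ‖s‖ ^ 3)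
    exact this.congr_deriv (by push_cast; ring)
  have key := image_norm_le_of_norm_deriv_right_le_deriv_boundary (a := (0 : ℝ)) (b := 1)
    (fun t _ => (hder t).continuousAt.continuousWithinAt)
    (fun t _ => (hder t).hasDerivWithinAt) (by simp) hB (fun t ht => ?_)
    (Set.right_mem_Icc.mpr zero_le_one)
  · simpa [Real.norm_eq_abs] using key
  · have hn : ‖t • s‖ = t * ‖s‖ := by simp [norm_smul, abs_of_nonneg ht.1]
    have hle : ‖t • s‖ ≤ δ := by
      rw [hn]; nlinarith [ht.1, ht.2, norm_nonneg s]
    calc ‖⟪gradient f (x + t • s) - gradient f x - hess f x (t • s), s⟫‖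
        ≤ ‖gradient f (x + t • s) - gradient f x - hess f x (t • s)‖ * ‖s‖ :=
          norm_inner_le_norm _ _
      _ ≤ L / 2 * ‖t • s‖ ^ 2 * ‖s‖ := by gcongr; exact norm_gradient_sub_le hf hL hle
      _ = L / 2 * t ^ 2 * ‖s‖ ^ 3 := by rw [hn]; ring

/-! ### Decrease of the quadratic model -/

/-- The decrease at the step `s` of the quadratic model with gradient `g` and Hessian `H`; this is
the denominator of the acceptance ratio. -/
noncomputable def modelDecrease {n : ℕ} (g : E n) (H : E n →L[ℝ] E n) (s : E n) : ℝ :=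
  -(⟪g, s⟫ + 1 / 2 * ⟪s, H s⟫)

/-- A residual orthogonal to the step makes the regularized Newton equation hold exactly when tested
against the step. -/
theorem neg_inner_eq_of_residual {n : ℕ} {g s : E n} {H : E n →L[ℝ] E n} {σ μ : ℝ}
    (h : ⟪residual g H σ μ s, s⟫ = 0) :
    -⟪g, s⟫ = ⟪s, H s⟫ + μ * ‖s‖ ^ 2 + Real.sqrt σ * ‖g‖ * ‖s‖ ^ 2 := by
  rw [residual, inner_add_left, inner_add_left, inner_smul_left, real_inner_self_eq_norm_sq,
    real_inner_comm] at h
  simp only [conj_trivial] at h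
  linarith

theorem newton_modelDecrease {n : ℕ} {g s : E n} {H : E n →L[ℝ] E n} {σ μ : ℝ} (hμ : 0 ≤ μ)
    (hc : 0 ≤ ⟪s, H s + μ • s⟫) (hr : ⟪residual g H σ μ s, s⟫ = 0) :
    Real.sqrt σ * ‖g‖ * ‖s‖ ^ 2 ≤ modelDecrease g H s := by
  have h := neg_inner_eq_of_residual hr
  rw [inner_add_right, inner_smul_right, real_inner_self_eq_norm_sq] at hc
  have := mul_nonneg hμ (sq_nonneg ‖s‖)
  rw [modelDecrease]
  linarith

theorem newton_sqrt_mul_norm_le {n : ℕ} {g s : E n} {H : E n →L[ℝ] E n} {σ μ : ℝ} (hg : 0 < ‖g‖)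
    (hc : 0 ≤ ⟪s, H s + μ • s⟫) (hr : ⟪residual g H σ μ s, s⟫ = 0) :
    Real.sqrt σ * ‖s‖ ≤ 1 := by
  rcases (norm_nonneg s).eq_or_lt with hs | hs
  · simp [← hs]
  have h := neg_inner_eq_of_residual hr
  rw [inner_add_right, inner_smul_right, real_inner_self_eq_norm_sq] at hc
  have h2 := (abs_le.mp (abs_real_inner_le_norm g s)).1
  have h3 : Real.sqrt σ * ‖s‖ * (‖g‖ * ‖s‖) ≤ 1 * (‖g‖ * ‖s‖) := by nlinarith
  exact le_of_mul_le_mul_right h3 (by positivity)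

theorem newton_ne_zero {n : ℕ} {g s : E n} {H : E n →L[ℝ] E n} {σ μ κ : ℝ} (hg : 0 < ‖g‖)
    (hκ : 0 ≤ κ) (hr : ‖residual g H σ μ s‖ ≤ κ * min (Real.sqrt σ * ‖g‖ * ‖s‖) ‖g‖) :
    s ≠ 0 := by
  rintro rfl
  have h : κ * min (Real.sqrt σ * ‖g‖ * ‖(0 : E n)‖) ‖g‖ ≤ κ * 0 := by
    gcongr
    exact (min_le_left _ _).trans (by simp)
  have : residual g H σ μ 0 = g := by simp [residual]
  rw [this] at hr
  linarith

/-- The gradient `g + H s` of the quadratic model differs from the residual by the regularization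
term. -/
theorem norm_add_le_of_residual {n : ℕ} {g s : E n} {H : E n →L[ℝ] E n} {σ μ : ℝ} (hμ : 0 ≤ μ) :
    ‖g + H s‖ ≤ ‖residual g H σ μ s‖ + (Real.sqrt σ * ‖g‖ + μ) * ‖s‖ := by
  have h : g + H s = residual g H σ μ s - (Real.sqrt σ * ‖g‖ + μ) • s := by
    rw [residual]; abel
  rw [h]
  refine (norm_sub_le _ _).trans (le_of_eq ?_)
  rw [norm_smul, Real.norm_of_nonneg (by positivity)]

theorem modelDecrease_smul_ge {n : ℕ} {g u : E n} {H : E n →L[ℝ] E n} {c m : ℝ} (hc : 0 ≤ c)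
    (hg : ⟪g, u⟫ ≤ 0) (hH : ⟪u, H u⟫ ≤ -m) :
    c ^ 2 * m / 2 ≤ modelDecrease g H (c • u) := by
  rw [modelDecrease, map_smul, inner_smul_right, inner_smul_right, inner_smul_left]
  simp only [conj_trivial]
  nlinarith [mul_nonneg hc (neg_nonneg.mpr hg), mul_nonneg (sq_nonneg c) (sub_nonneg.mpr hH)]

/-! ### Steps are accepted when the regularization is large -/

theorem le_ratio_of_taylor {n : ℕ} {f : E n → ℝ} {x s : E n} {η e : ℝ}
    (hD : 0 < modelDecrease (gradient f x) (hess f x) s)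
    (hT : |f (x + s) - f x - (⟪gradient f x, s⟫ + 1 / 2 * ⟪s, hess f x s⟫)| ≤ e)
    (he : e ≤ (1 - η) * modelDecrease (gradient f x) (hess f x) s) : η ≤ ratio f x s := by
  rw [ratio, ← modelDecrease, le_div_iff₀ hD]
  have := (abs_le.mp hT).2
  simp only [modelDecrease] at *
  linarith

theorem norm_gradient_add_le {n : ℕ} {f : E n → ℝ} {x s : E n} {e : ℝ}
    (h : ‖gradient f (x + s) - gradient f x - hess f x s‖ ≤ e) :
    ‖gradient f (x + s)‖ ≤ ‖gradient f x + hess f x s‖ + e := by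
  have h1 : gradient f (x + s) = (gradient f x + hess f x s) +
      (gradient f (x + s) - gradient f x - hess f x s) := by abel
  rw [h1]
  refine (norm_add_le _ _).trans ?_
  gcongr

/-- `κ_slow` is the positive root of `κ² = 2 (1 + κ_θ + κ_C) κ + ϑ`. -/
theorem kappaSlow_sq (P : Params) :
    kappaSlow P ^ 2 = 2 * (1 + P.κθ + P.κC) * kappaSlow P + P.vartheta := by
  have h := Real.sq_sqrt (x := (1 + P.κθ + P.κC) ^ 2 + P.vartheta)
    (by have := P.one_le_vartheta; positivity)
  rw [kappaSlow]
  linear_combination h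

theorem kappaSlow_pos (P : Params) : 0 < kappaSlow P := by
  have h1 := P.one_le_κC
  have h2 := P.κθ_nonneg
  have h3 := Real.sqrt_nonneg ((1 + P.κθ + P.κC) ^ 2 + P.vartheta)
  rw [kappaSlow]
  linarith

/-- The value of `σ ε₁` above which first-order steps are very successful. -/
noncomputable def firstOrderThreshold (P : Params) (L₀ L₁ δ : ℝ) : ℝ :=
  max P.σ₀ (max (P.κC ^ 2 * P.θ ^ 2 / δ ^ 2) (max (1 / δ ^ 2)
    (max ((L₀ + L₁) / (3 * (1 - P.η₂))) ((L₀ + L₁) / P.vartheta))))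

/-- The value of `σ ε₂²` above which second-order steps are very successful. -/
noncomputable def secondOrderThreshold (P : Params) (L₀ L₁ δ : ℝ) : ℝ :=
  max (1 / δ ^ 2) ((L₀ + L₁) ^ 2 / (9 * (1 - P.η₂) ^ 2))

theorem div_sqrt_le_of_sq_div_le {a δ σ : ℝ} (hδ : 0 < δ) (hσ : 0 < σ)
    (h : a ^ 2 / δ ^ 2 ≤ σ) : a / Real.sqrt σ ≤ δ := by
  rw [div_le_iff₀ (Real.sqrt_pos.mpr hσ)]
  refine le_of_sq_le_sq ?_ (by positivity)
  rw [mul_pow, Real.sq_sqrt hσ.le]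
  rwa [div_le_iff₀ (by positivity), mul_comm] at h

/-- Where the gradient is not small, the local Lipschitz constant of the Hessian is bounded by a
multiple of the gradient. -/
theorem lipschitz_le_of_div_le {L₀ L₁ ε G c σ : ℝ} (h₀ : 0 ≤ L₀) (h₁ : 0 ≤ L₁) (hε : 0 < ε)
    (hε1 : ε ≤ 1) (hG : ε < G) (hc : 0 < c) (h : (L₀ + L₁) / c ≤ σ * ε) :
    L₀ + L₁ * G ≤ c * σ * G := by
  rw [div_le_iff₀ hc] at h
  have hG0 : 0 < G := hε.trans hG
  refine le_of_mul_le_mul_right ?_ hε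
  calc (L₀ + L₁ * G) * ε = L₀ * ε + L₁ * G * ε := by ring
    _ ≤ L₀ * G + L₁ * G * 1 := by gcongr
    _ = (L₀ + L₁) * G := by ring
    _ ≤ σ * ε * c * G := by gcongr
    _ = c * σ * G * ε := by ring

/-- A Newton step is very successful once `L` is small relative to `σ ‖∇f(x)‖`. A short step that
does not halve the gradient is then impossible: `t = √σ ‖s‖` would satisfy both `t κ_slow < 1` and
`1 < 2 (1 + κ_θ + κ_C) t + ϑ t²`, and `1 / κ_slow` is the positive root of the quadratic. -/
theorem newton_accepted {n : ℕ} {P : Params} {f : E n → ℝ} (hf : ContDiff ℝ 2 f) {L δ σ μ : ℝ}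
    {x s : E n} (hLip : ∀ y, ‖x - y‖ ≤ δ → ‖hess f y - hess f x‖ ≤ L * ‖x - y‖)
    (hσ : 0 < σ) (hg : P.ε₁ < ‖gradient f x‖) (hδ : 1 / Real.sqrt σ ≤ δ)
    (hη : L ≤ 3 * (1 - P.η₂) * σ * ‖gradient f x‖) (hϑ : L ≤ P.vartheta * σ * ‖gradient f x‖)
    (hN : IsNewton P (gradient f x) σ μ) (hs : StepComp P (gradient f x) (hess f x) σ s μ) :
    ¬ FirstOrderRejected P f x σ s μ ∧ P.η₂ ≤ ratio f x s := by
  obtain ⟨hμ, hs, -⟩ := hs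
  obtain ⟨hcurv, hres, horth⟩ := hs hN
  have hg0 : 0 < ‖gradient f x‖ := P.ε₁_pos.trans hg
  have hne := newton_ne_zero hg0 P.κθ_nonneg hres
  have hS : 0 < ‖s‖ := norm_pos_iff.mpr hne
  have hq : 0 < Real.sqrt σ := Real.sqrt_pos.mpr hσ
  have hqS := newton_sqrt_mul_norm_le hg0 hcurv horth
  have hD := newton_modelDecrease hμ hcurv horth
  have hsδ : ‖s‖ ≤ δ := by
    refine le_trans ?_ hδ
    rw [le_div_iff₀ hq]; linarith
  have hgrad := norm_gradient_add_le (norm_gradient_sub_le hf hLip hsδ)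
  have hres' := norm_add_le_of_residual (g := gradient f x) (s := s) (H := hess f x) (σ := σ) hμ
  have htay := abs_taylor_sub_le hf hLip hsδ
  unfold IsNewton at hN
  have hη2 := P.η₂_lt_one
  have hε1 := P.ε₁_pos
  have hκC := P.one_le_κC
  have hκθ := P.κθ_nonneg
  have hvt := P.one_le_vartheta
  set G := ‖gradient f x‖
  set S := ‖s‖
  set q := Real.sqrt σ
  have hσq : σ = q ^ 2 := (Real.sq_sqrt hσ.le).symm
  rw [hσq] at hη hϑ
  have hGS : 0 < q * G * S ^ 2 := by positivity
  have hratio : P.η₂ ≤ ratio f x s := by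
    refine le_ratio_of_taylor (hGS.trans_le hD) htay ?_
    calc L / 6 * S ^ 3 ≤ 3 * (1 - P.η₂) * q ^ 2 * G / 6 * S ^ 3 := by gcongr
      _ = (1 - P.η₂) / 2 * (q * G * S ^ 2) * (q * S) := by ring
      _ ≤ (1 - P.η₂) * (q * G * S ^ 2) * 1 := by
          have : 0 ≤ 1 - P.η₂ := by linarith
          gcongr
          linarith
      _ ≤ _ := by
          rw [mul_one]
          gcongr
  refine ⟨?_, hratio⟩
  -- The model gradient `g + H s` is small twice: relative to `√σ ‖g‖ ‖s‖` and to `‖g‖`.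
  have hmodel : ‖gradient f x + hess f x s‖ ≤
      P.κθ * min (q * G * S) G + (1 + P.κC) * G * (q * S) := by
    calc _ ≤ P.κθ * min (q * G * S) G + (q * G + P.κC * q * G) * S := by
          refine hres'.trans ?_
          gcongr
      _ = _ := by ring
  rintro (⟨-, hhalf, hshort⟩ | hrej | hrej)
  · have hκ := kappaSlow_pos P
    have hκ2 := kappaSlow_sq P
    set κ := kappaSlow P
    set a := 1 + P.κθ + P.κC with ha
    rw [lt_div_iff₀ (by positivity)] at hshort
    have h1 : ‖gradient f (x + s)‖ ≤ G * (a * (q * S) + P.vartheta / 2 * (q * S) ^ 2) := by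
      calc _ ≤ P.κθ * (q * G * S) + (1 + P.κC) * G * (q * S) +
              P.vartheta * q ^ 2 * G / 2 * S ^ 2 := by
            refine hgrad.trans ?_
            gcongr
            exact hmodel.trans (by gcongr; exact min_le_left _ _)
        _ = _ := by rw [ha]; ring
    set t := q * S
    have ht : 0 < t := by positivity
    have h2 : 1 < 2 * a * t + P.vartheta * t ^ 2 := by
      have : G * 1 < G * (2 * a * t + P.vartheta * t ^ 2) := by linarith
      exact lt_of_mul_lt_mul_left this hg0.le
    have hy : t * κ < 1 := by
      rw [show t * κ = S * (q * κ) by simp only [t]; ring]; exact hshort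
    have ha0 : 0 < a := by positivity
    have h3 : (2 * a * t + P.vartheta * t ^ 2) * κ ^ 2 ≤ 1 * κ ^ 2 := by
      calc (2 * a * t + P.vartheta * t ^ 2) * κ ^ 2
          = 2 * a * κ * (t * κ) + P.vartheta * (t * κ) ^ 2 := by ring
        _ ≤ 2 * a * κ * 1 + P.vartheta * 1 ^ 2 := by gcongr
        _ = 1 * κ ^ 2 := by rw [hκ2]; ring
    exact absurd (le_of_mul_le_mul_right h3 (by positivity)) (not_le.mpr h2)
  · linarith [P.η₁_le_η₂]
  · rw [kappaFO, if_pos (show IsNewton P (gradient f x) σ μ by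
      unfold IsNewton; exact hN)] at hrej
    refine absurd hrej (not_lt.mpr ?_)
    have hGε : G ≤ G / P.ε₁ := by
      rw [le_div_iff₀ hε1]; nlinarith [P.ε₁_le_one]
    have hκ0 : 0 ≤ kappaUpNewt P := by rw [kappaUpNewt]; linarith
    refine le_trans ?_ (mul_le_mul_of_nonneg_left hGε hκ0)
    calc _ ≤ P.κθ * G + (1 + P.κC) * G * 1 + 3 * (1 - P.η₂) * q ^ 2 * G / 2 * S ^ 2 := by
          refine hgrad.trans ?_
          gcongr
          exact hmodel.trans (by gcongr; exact min_le_right _ _)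
      _ = P.κθ * G + (1 + P.κC) * G * 1 + 3 * (1 - P.η₂) * G / 2 * (q * S) ^ 2 := by ring
      _ ≤ P.κθ * G + (1 + P.κC) * G * 1 + 3 * (1 - P.η₂) * G / 1 * 1 ^ 2 := by
          have : 0 ≤ 1 - P.η₂ := by linarith
          gcongr
          norm_num
      _ = kappaUpNewt P * G := by rw [kappaUpNewt]; ring

theorem norm_apply_sq_le {n : ℕ} {f : E n → ℝ} (hf : ContDiff ℝ 2 f) {x u : E n} {m : ℝ}
    (hm : 0 ≤ m) (h : ⟪u, hess f x (hess f x u)⟫ ≤ m ^ 2) : ‖hess f x u‖ ≤ m := by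
  rw [← inner_hess_comm hf, real_inner_self_eq_norm_sq] at h
  exact le_of_sq_le_sq h hm

theorem negativeCurvature_accepted {n : ℕ} {P : Params} {f : E n → ℝ} (hf : ContDiff ℝ 2 f)
    {L δ σ μ : ℝ} {x s : E n}
    (hLip : ∀ y, ‖x - y‖ ≤ δ → ‖hess f y - hess f x‖ ≤ L * ‖x - y‖)
    (hσ : 0 < σ) (hg : P.ε₁ < ‖gradient f x‖) (hδ : P.θ * P.κC / Real.sqrt σ ≤ δ)
    (hη : L ≤ 3 * (1 - P.η₂) * σ * ‖gradient f x‖)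
    (hN : ¬ IsNewton P (gradient f x) σ μ)
    (hs : StepComp P (gradient f x) (hess f x) σ s μ) :
    ¬ FirstOrderRejected P f x σ s μ ∧ P.η₂ ≤ ratio f x s := by
  obtain ⟨hμ, -, hs⟩ := hs
  obtain ⟨u, rfl, hgu, hu, hcurv, hsq⟩ := hs hN
  have hg0 : 0 < ‖gradient f x‖ := P.ε₁_pos.trans hg
  have hq : 0 < Real.sqrt σ := Real.sqrt_pos.mpr hσ
  have hθ := P.θ_pos
  have hκC := P.one_le_κC
  have hη2 : 0 < 1 - P.η₂ := sub_pos.mpr P.η₂_lt_one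
  have hε1 := P.ε₁_pos
  have hS : ‖(P.θ * P.κC / Real.sqrt σ) • u‖ = P.θ * P.κC / Real.sqrt σ := by
    rw [norm_smul, hu, mul_one, Real.norm_of_nonneg (by positivity)]
  have hD := modelDecrease_smul_ge (c := P.θ * P.κC / Real.sqrt σ) (by positivity) hgu
    (hcurv.trans_eq (neg_mul _ _))
  have hgrad := norm_gradient_add_le (norm_gradient_sub_le hf hLip (hS.trans_le hδ))
  have htay := abs_taylor_sub_le hf hLip (hS.trans_le hδ)
  have hHu : ‖hess f x u‖ ≤ μ / P.θ :=
    norm_apply_sq_le hf (by positivity) (by rwa [div_pow])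
  rw [hS] at hgrad htay
  have hN' : P.κC * Real.sqrt σ * ‖gradient f x‖ < μ := not_le.mp hN
  set G := ‖gradient f x‖
  set q := Real.sqrt σ
  have hσq : σ = q ^ 2 := (Real.sq_sqrt hσ.le).symm
  rw [hσq] at hη
  have hD' : (P.θ * P.κC / q) ^ 2 * (P.θ * (P.κC * q * G)) / 2 ≤
      modelDecrease (gradient f x) (hess f x) ((P.θ * P.κC / q) • u) :=
    le_trans (by gcongr) hD
  have hratio : P.η₂ ≤ ratio f x ((P.θ * P.κC / q) • u) := by
    refine le_ratio_of_taylor (lt_of_lt_of_le (by positivity) hD') htay ?_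
    calc L / 6 * (P.θ * P.κC / q) ^ 3
        ≤ 3 * (1 - P.η₂) * q ^ 2 * G / 6 * (P.θ * P.κC / q) ^ 3 := by gcongr
      _ = (1 - P.η₂) * ((P.θ * P.κC / q) ^ 2 * (P.θ * (P.κC * q * G)) / 2) := by
          field_simp
          ring
      _ ≤ _ := by gcongr
  refine ⟨?_, hratio⟩
  rintro (⟨h, -⟩ | hrej | hrej)
  · exact hN h
  · linarith [P.η₁_le_η₂]
  · rw [kappaFO, if_neg hN] at hrej
    refine absurd hrej (not_lt.mpr ?_)
    have hGε : G ≤ G / P.ε₁ := by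
      rw [le_div_iff₀ hε1]; nlinarith [P.ε₁_le_one]
    have h1 : 1 ≤ G / P.ε₁ := by rw [le_div_iff₀ hε1]; linarith
    have hHs : ‖hess f x ((P.θ * P.κC / q) • u)‖ ≤ P.κC * μ / q := by
      rw [map_smul, norm_smul, Real.norm_of_nonneg (by positivity)]
      calc P.θ * P.κC / q * ‖hess f x u‖ ≤ P.θ * P.κC / q * (μ / P.θ) := by gcongr
        _ = P.κC * μ / q := by field_simp
    calc ‖gradient f (x + (P.θ * P.κC / q) • u)‖
        ≤ (G + P.κC * μ / q) + 3 * (1 - P.η₂) * q ^ 2 * G / 2 * (P.θ * P.κC / q) ^ 2 := by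
          refine hgrad.trans ?_
          gcongr
          exact (norm_add_le _ _).trans (by gcongr)
      _ = (3 / 2 * P.κC ^ 2 * P.θ ^ 2 * (1 - P.η₂) + 1) * G + P.κC * μ / q * 1 := by
          field_simp
          ring
      _ ≤ (3 / 2 * P.κC ^ 2 * P.θ ^ 2 * (1 - P.η₂) + 1) * (G / P.ε₁) +
            P.κC * μ / q * (G / P.ε₁) := by gcongr
      _ = _ := by ring

theorem firstOrder_accepted {n : ℕ} {P : Params} {f : E n → ℝ} (hf : ContDiff ℝ 2 f)
    {L₀ L₁ δ σ μ : ℝ} (hsm : LocallySmoothHessian f L₀ L₁ δ) {x s : E n} (hσ : 0 < σ)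
    (hg : P.ε₁ < ‖gradient f x‖) (hs : StepComp P (gradient f x) (hess f x) σ s μ)
    (hT : firstOrderThreshold P L₀ L₁ δ ≤ σ * P.ε₁) :
    ¬ FirstOrderRejected P f x σ s μ ∧ P.η₂ ≤ ratio f x s := by
  obtain ⟨hL₀, hL₁, hδ, hLip⟩ := hsm
  simp only [firstOrderThreshold, max_le_iff] at hT
  obtain ⟨-, hC, h1, hη, hϑ⟩ := hT
  have hσε : σ * P.ε₁ ≤ σ := mul_le_of_le_one_right hσ.le P.ε₁_le_one
  have hη2 : 0 < 1 - P.η₂ := sub_pos.mpr P.η₂_lt_one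
  have hη' := lipschitz_le_of_div_le hL₀ hL₁ P.ε₁_pos P.ε₁_le_one hg (by positivity) hη
  by_cases hN : IsNewton P (gradient f x) σ μ
  · refine newton_accepted hf (hLip x) hσ hg ?_ hη' ?_ hN hs
    · exact div_sqrt_le_of_sq_div_le hδ hσ (by rw [one_pow]; exact h1.trans hσε)
    · exact lipschitz_le_of_div_le hL₀ hL₁ P.ε₁_pos P.ε₁_le_one hg
        (by linarith [P.one_le_vartheta]) hϑ
  · refine negativeCurvature_accepted hf (hLip x) hσ hg ?_ hη' hN hs
    exact div_sqrt_le_of_sq_div_le hδ hσ (by rw [mul_pow, mul_comm]; exact hC.trans hσε)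

theorem secondOrder_accepted {n : ℕ} {P : Params} {f : E n → ℝ} (hf : ContDiff ℝ 2 f)
    {L₀ L₁ δ σ : ℝ} (hsm : LocallySmoothHessian f L₀ L₁ δ) {x s : E n} (hmin : P.σmin ≤ σ)
    (hg : ‖gradient f x‖ ≤ P.ε₁) (hneg : lambdaMin (hess f x) < -P.ε₂)
    (hs : SecondOrderStep (gradient f x) (hess f x) σ s)
    (hT : secondOrderThreshold P L₀ L₁ δ ≤ σ * P.ε₂ ^ 2) :
    ¬ SecondOrderRejected P f x σ s ∧ P.η₂ ≤ ratio f x s := by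
  obtain ⟨hL₀, hL₁, hδ, hLip⟩ := hsm
  simp only [secondOrderThreshold, max_le_iff] at hT
  obtain ⟨h1, h2⟩ := hT
  obtain ⟨u, rfl, hgu, hu, heig⟩ := hs
  have hσ : 0 < σ := P.σmin_pos.trans_le hmin
  have hq : 0 < Real.sqrt σ := Real.sqrt_pos.mpr hσ
  have hqm : 0 < Real.sqrt P.σmin := Real.sqrt_pos.mpr P.σmin_pos
  have hqq : Real.sqrt P.σmin ≤ Real.sqrt σ := Real.sqrt_le_sqrt hmin
  have hη2 : 0 < 1 - P.η₂ := sub_pos.mpr P.η₂_lt_one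
  have hε2 := P.ε₂_pos
  have hG1 : ‖gradient f x‖ ≤ 1 := hg.trans P.ε₁_le_one
  set l := lambdaMin (hess f x) with hl
  have habs : |l| = -l := abs_of_neg (by linarith)
  have hl0 : 0 < |l| := by linarith
  have hS : ‖(1 / Real.sqrt σ) • u‖ = 1 / Real.sqrt σ := by
    rw [norm_smul, hu, mul_one, Real.norm_of_nonneg (by positivity)]
  have hsδ : ‖(1 / Real.sqrt σ) • u‖ ≤ δ := by
    rw [hS]
    refine div_sqrt_le_of_sq_div_le hδ hσ ?_
    rw [one_pow]
    exact h1.trans (mul_le_of_le_one_right hσ.le (pow_le_one₀ hε2.le P.ε₂_le_one))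
  have hcurv : ⟪u, hess f x u⟫ ≤ -|l| := by
    rw [heig, inner_smul_right, real_inner_self_eq_norm_sq, hu, habs]
    simp
  have hD := modelDecrease_smul_ge (c := 1 / Real.sqrt σ) (by positivity) hgu hcurv
  have hgrad := norm_gradient_add_le (norm_gradient_sub_le hf (hLip x) hsδ)
  have htay := abs_taylor_sub_le hf (hLip x) hsδ
  rw [hS] at hgrad htay
  have hHs : ‖hess f x ((1 / Real.sqrt σ) • u)‖ = |l| / Real.sqrt σ := by
    rw [map_smul, heig, norm_smul, norm_smul, hu, Real.norm_of_nonneg (by positivity),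
      Real.norm_eq_abs]
    ring
  have hL : L₀ + L₁ * ‖gradient f x‖ ≤ 3 * (1 - P.η₂) * Real.sqrt σ * |l| := by
    have h3 : (L₀ + L₁) ≤ 3 * (1 - P.η₂) * Real.sqrt σ * P.ε₂ := by
      refine le_of_sq_le_sq ?_ (by positivity)
      rw [div_le_iff₀ (by positivity)] at h2
      refine h2.trans_eq ?_
      simp only [mul_pow, Real.sq_sqrt hσ.le]
      ring
    calc L₀ + L₁ * ‖gradient f x‖ ≤ L₀ + L₁ * 1 := by gcongr
      _ = L₀ + L₁ := by ring
      _ ≤ _ := h3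
      _ ≤ _ := by gcongr; linarith
  set L := L₀ + L₁ * ‖gradient f x‖
  set q := Real.sqrt σ
  have hratio : P.η₂ ≤ ratio f x ((1 / q) • u) := by
    refine le_ratio_of_taylor (lt_of_lt_of_le (by positivity) hD) htay ?_
    calc L / 6 * (1 / q) ^ 3 ≤ 3 * (1 - P.η₂) * q * |l| / 6 * (1 / q) ^ 3 := by gcongr
      _ = (1 - P.η₂) * ((1 / q) ^ 2 * |l| / 2) := by
          field_simp
          ring
      _ ≤ _ := by gcongr
  refine ⟨?_, hratio⟩
  rintro (hrej | hrej)
  · linarith [P.η₁_le_η₂]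
  · refine absurd hrej (not_lt.mpr ?_)
    rw [kappaHess, ← hl]
    calc ‖gradient f (x + (1 / q) • u)‖
        ≤ (1 + |l| / q) + 3 * (1 - P.η₂) * q * |l| / 2 * (1 / q) ^ 2 := by
          refine hgrad.trans ?_
          gcongr
          exact (norm_add_le _ _).trans (by rw [hHs]; gcongr)
      _ = 3 * (1 - P.η₂) * |l| / (2 * q) + 1 + |l| / q := by
          field_simp
          ring
      _ ≤ _ := by gcongr

/-! ### Bounds on the regularization parameter -/

/-- The upper bound on all regularization parameters of a run. -/
noncomputable def regBound (P : Params) (L₀ L₁ δ : ℝ) : ℝ :=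
  max (kappaMax1 P L₀ L₁ δ * P.ε₁⁻¹) (kappaMax2 P L₀ L₁ δ * (P.ε₂ ^ 2)⁻¹)

theorem Params.γ₃_pos (P : Params) : 0 < P.γ₃ :=
  (zero_lt_one.trans P.one_lt_γ₂).trans_le P.γ₂_le_γ₃

theorem Params.σ₀_pos (P : Params) : 0 < P.σ₀ := P.σmin_pos.trans_le P.σmin_le

theorem kappaMax1_pos (P : Params) (L₀ L₁ δ : ℝ) : 0 < kappaMax1 P L₀ L₁ δ :=
  mul_pos P.γ₃_pos (P.σ₀_pos.trans_le (le_max_left _ _))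

theorem kappaMax1_eq (P : Params) (L₀ L₁ δ : ℝ) :
    kappaMax1 P L₀ L₁ δ = P.γ₃ * firstOrderThreshold P L₀ L₁ δ := rfl

theorem kappaMax2_eq (P : Params) (L₀ L₁ δ : ℝ) :
    kappaMax2 P L₀ L₁ δ = P.γ₃ * secondOrderThreshold P L₀ L₁ δ := rfl

theorem regBound_pos (P : Params) (L₀ L₁ δ : ℝ) : 0 < regBound P L₀ L₁ δ :=
  lt_max_of_lt_left (mul_pos (kappaMax1_pos P L₀ L₁ δ) (inv_pos.mpr P.ε₁_pos))

theorem lambdaMin_lt_of_not_terminated {n : ℕ} {P : Params} {f : E n → ℝ} {x : E n}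
    (h : ¬ Terminated P f x) (hg : ‖gradient f x‖ ≤ P.ε₁) : lambdaMin (hess f x) < -P.ε₂ :=
  not_le.mp fun h' => h ⟨hg, h'⟩

theorem accepted_of_regBound_lt {n : ℕ} {P : Params} {f : E n → ℝ} (hf : ContDiff ℝ 2 f)
    {L₀ L₁ δ σ μ : ℝ} (hsm : LocallySmoothHessian f L₀ L₁ δ) {x s : E n} (hmin : P.σmin ≤ σ)
    (hx : ¬ Terminated P f x) (ht : TrialStep P f x σ s μ)
    (hσ : regBound P L₀ L₁ δ < P.γ₃ * σ) :
    ¬ Rejected P f x σ s μ ∧ P.η₂ ≤ ratio f x s := by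
  have hσ0 := P.σmin_pos.trans_le hmin
  obtain ⟨h1, h2⟩ := max_lt_iff.mp hσ
  have hγ := P.γ₃_pos
  have hε1 := P.ε₁_pos
  have hε2 := P.ε₂_pos
  rcases lt_or_ge P.ε₁ ‖gradient f x‖ with hg | hg
  · have hT : firstOrderThreshold P L₀ L₁ δ ≤ σ * P.ε₁ := by
      rw [← div_eq_mul_inv, div_lt_iff₀ hε1, kappaMax1_eq, mul_assoc] at h1
      exact (lt_of_mul_lt_mul_left h1 hγ.le).le
    obtain ⟨ha, hr⟩ := firstOrder_accepted hf hsm hσ0 hg (ht.1 hg) hT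
    exact ⟨fun h => h.elim (fun h => ha h.2) (fun h => absurd hg (not_lt.mpr h.1)), hr⟩
  · have hT : secondOrderThreshold P L₀ L₁ δ ≤ σ * P.ε₂ ^ 2 := by
      rw [← div_eq_mul_inv, div_lt_iff₀ (by positivity), kappaMax2_eq, mul_assoc] at h2
      exact (lt_of_mul_lt_mul_left h2 hγ.le).le
    obtain ⟨ha, hr⟩ := secondOrder_accepted hf hsm hmin hg
      (lambdaMin_lt_of_not_terminated hx hg) (ht.2 hg) hT
    exact ⟨fun h => h.elim (fun h => absurd h.1 (not_lt.mpr hg)) (fun h => ha h.2), hr⟩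

theorem active_of_lt {p : ℕ → Prop} {k : ℕ} (h : ∀ j < k + 1, ¬ p j) : ∀ j ≤ k, ¬ p j :=
  fun j hj => h j (Nat.lt_succ_of_le hj)

/-- A rejected or merely successful iteration has `γ₃ σ k ≤ regBound`, so `σ` cannot grow past
`regBound`. -/
theorem IsRun.sigma_mem {n : ℕ} {P : Params} {f : E n → ℝ} {x s : ℕ → E n} {μ σ : ℕ → ℝ}
    (hrun : IsRun P f x s μ σ) (hf : ContDiff ℝ 2 f) {L₀ L₁ δ : ℝ}
    (hsm : LocallySmoothHessian f L₀ L₁ δ) (k : ℕ) (hk : ∀ j < k, ¬ Terminated P f (x j)) :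
    σ k ∈ Set.Icc P.σmin (regBound P L₀ L₁ δ) := by
  induction k with
  | zero =>
    rw [hrun.init]
    refine ⟨P.σmin_le, le_trans ?_ (le_max_left _ _)⟩
    have h1 : P.σ₀ ≤ firstOrderThreshold P L₀ L₁ δ := le_max_left _ _
    have h0 := P.σ₀_pos.trans_le h1
    have h0' := P.σ₀_pos
    have hγ := P.γ₃_pos
    rw [kappaMax1_eq]
    have h2 : 1 ≤ P.γ₃ := (P.one_lt_γ₂.trans_le P.γ₂_le_γ₃).le
    have h3 : 1 ≤ P.ε₁⁻¹ := (one_le_inv₀ P.ε₁_pos).mpr P.ε₁_le_one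
    calc P.σ₀ = 1 * P.σ₀ * 1 := by ring
      _ ≤ _ := by gcongr
  | succ k ih =>
    obtain ⟨hmin, hmax⟩ := ih fun j hj => hk j (by omega)
    have hact := active_of_lt hk
    have hσ0 := P.σmin_pos.trans_le hmin
    have hacc := accepted_of_regBound_lt hf hsm hmin (hact k le_rfl) (hrun.trial k hact)
    have h23 : P.γ₂ * σ k ≤ P.γ₃ * σ k := by have := P.γ₂_le_γ₃; gcongr
    have h2 : σ k ≤ P.γ₂ * σ k := le_mul_of_one_le_left hσ0.le P.one_lt_γ₂.le
    by_cases hrej : Rejected P f (x k) (σ k) (s k) (μ k)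
    · obtain ⟨ha, hb⟩ := hrun.sigma_unsuccessful k hact hrej
      refine ⟨by linarith, hb.trans (not_lt.mp fun h => (hacc h).1 hrej)⟩
    · rcases le_or_gt P.η₂ (ratio f (x k) (s k)) with hη | hη
      · obtain ⟨ha, hb⟩ := hrun.sigma_verySuccessful k hact hrej hη
        exact ⟨(le_max_left _ _).trans ha, hb.trans hmax⟩
      · obtain ⟨ha, hb⟩ := hrun.sigma_successful k hact hrej hη
        exact ⟨hmin.trans ha,
          hb.trans (h23.trans (not_lt.mp fun h => absurd hη (not_lt.mpr (hacc h).2)))⟩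

/-! ### The gradient potential -/

/-- The number of halvings, up to an additive constant, that bring a gradient of norm `G` down to
the tolerance `ε`. Truncation at `0` makes it insensitive to how far below `ε` the norm is. -/
noncomputable def gradPotential (ε G : ℝ) : ℝ :=
  Real.log (max 1 (2 * G / ε)) / Real.log 2

theorem gradPotential_nonneg (ε G : ℝ) : 0 ≤ gradPotential ε G :=
  div_nonneg (Real.log_nonneg (le_max_left _ _)) (Real.log_nonneg one_le_two)

theorem log_div_eq_add_abs_log {κ ε : ℝ} (hκ : 0 < κ) (hε : 0 < ε) (hε1 : ε ≤ 1) :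
    Real.log (κ / ε) = Real.log κ + |Real.log ε| := by
  rw [Real.log_div hκ.ne' hε.ne', abs_of_nonpos (Real.log_nonpos hε.le hε1), sub_eq_add_neg]

theorem gradPotential_le_add {ε κ G G' : ℝ} (hε : 0 < ε) (hε1 : ε ≤ 1) (hκ : 1 ≤ κ)
    (h : G' ≤ κ * (G / ε)) :
    gradPotential ε G' ≤ gradPotential ε G + (Real.log κ + |Real.log ε|) / Real.log 2 := by
  have hκ0 : 0 < κ := by linarith
  have hm : 0 < max 1 (2 * G / ε) := lt_max_of_lt_left one_pos
  rw [gradPotential, gradPotential, ← add_div, ← log_div_eq_add_abs_log hκ0 hε hε1,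
    ← Real.log_mul hm.ne' (by positivity)]
  have h2 := Real.log_pos one_lt_two
  gcongr
  refine max_le ?_ ?_
  · have : 1 ≤ κ / ε := by rw [le_div_iff₀ hε]; linarith
    calc (1 : ℝ) = 1 * 1 := by ring
      _ ≤ _ := by gcongr; exact le_max_left _ _
  · calc 2 * G' / ε ≤ 2 * (κ * (G / ε)) / ε := by gcongr
      _ = 2 * G / ε * (κ / ε) := by ring
      _ ≤ _ := by gcongr; exact le_max_right _ _

theorem gradPotential_le_of_le {ε κ G : ℝ} (hε : 0 < ε) (hε1 : ε ≤ 1) (hκ : 1 ≤ κ)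
    (h : G ≤ κ) : gradPotential ε G ≤ 1 + (Real.log κ + |Real.log ε|) / Real.log 2 := by
  have h2 := Real.log_pos one_lt_two
  have hκ0 : 0 < κ := by linarith
  have h1 : 1 ≤ κ / ε := by rw [le_div_iff₀ hε]; linarith
  rw [gradPotential, one_add_div h2.ne', ← log_div_eq_add_abs_log hκ0 hε hε1,
    ← Real.log_mul two_ne_zero (by positivity)]
  gcongr
  refine max_le (by linarith) ?_
  rw [mul_div_assoc]
  gcongr

theorem gradPotential_add_one_le {ε G G' : ℝ} (hε : 0 < ε) (hG : ε < G) (h : G' ≤ G / 2) :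
    gradPotential ε G' + 1 ≤ gradPotential ε G := by
  have h2 := Real.log_pos one_lt_two
  have h1 : 1 ≤ G / ε := by rw [le_div_iff₀ hε]; linarith
  rw [gradPotential, gradPotential, div_add_one h2.ne']
  have hm : 0 < max 1 (2 * G' / ε) := lt_max_of_lt_left one_pos
  rw [← Real.log_mul hm.ne' two_ne_zero]
  gcongr
  refine le_max_of_le_right ?_
  have : max 1 (2 * G' / ε) ≤ G / ε := by
    refine max_le h1 ?_
    gcongr
    linarith
  calc _ ≤ G / ε * 2 := by gcongr
    _ = 2 * G / ε := by ring

/-! ### Progress of an accepted step -/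

theorem ratio_mul_le {n : ℕ} {f : E n → ℝ} {x s : E n} {η c : ℝ} (hη : 0 < η) (hc : 0 < c)
    (hD : c ≤ modelDecrease (gradient f x) (hess f x) s) (hr : η ≤ ratio f x s) :
    η * c ≤ f x - f (x + s) := by
  rw [ratio, ← modelDecrease, le_div_iff₀ (hc.trans_le hD)] at hr
  exact le_trans (by gcongr) hr

/-- An upper bound on the inverse of the decrease of `f` at an accepted negative-curvature step. -/
noncomputable def weightNcurv (P : Params) (L₀ L₁ δ : ℝ) : ℝ :=
  1 / (P.η₁ * (P.κC ^ 3 * P.θ ^ 3 * P.ε₁ / (2 * Real.sqrt (regBound P L₀ L₁ δ))))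

/-- An upper bound on the inverse of the decrease of `f` at an accepted Newton step that is not
short. -/
noncomputable def weightDecr (P : Params) (L₀ L₁ δ : ℝ) : ℝ :=
  1 / (P.η₁ * (P.ε₁ / (kappaSlow P ^ 2 * Real.sqrt (regBound P L₀ L₁ δ))))

/-- An upper bound on the inverse of the decrease of `f` at an accepted second-order step. -/
noncomputable def weightSo (P : Params) (L₀ L₁ δ : ℝ) : ℝ :=
  1 / (P.η₁ * (P.ε₂ / (2 * regBound P L₀ L₁ δ)))

theorem weightNcurv_pos (P : Params) (L₀ L₁ δ : ℝ) : 0 < weightNcurv P L₀ L₁ δ := by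
  have hη1 := P.η₁_pos
  have hκC := P.one_le_κC
  have hθ := P.θ_pos
  have hε1 := P.ε₁_pos
  have hreg := regBound_pos P L₀ L₁ δ
  rw [weightNcurv]
  positivity

theorem weightDecr_pos (P : Params) (L₀ L₁ δ : ℝ) : 0 < weightDecr P L₀ L₁ δ := by
  have hη1 := P.η₁_pos
  have hκs := kappaSlow_pos P
  have hε1 := P.ε₁_pos
  have hreg := regBound_pos P L₀ L₁ δ
  rw [weightDecr]
  positivity

theorem weightSo_pos (P : Params) (L₀ L₁ δ : ℝ) : 0 < weightSo P L₀ L₁ δ := by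
  have hη1 := P.η₁_pos
  have hε2 := P.ε₂_pos
  have hreg := regBound_pos P L₀ L₁ δ
  rw [weightSo]
  positivity

theorem one_le_weight_mul {η c d : ℝ} (hη : 0 < η) (hc : 0 < c) (h : η * c ≤ d) :
    1 ≤ 1 / (η * c) * d := by
  rw [div_mul_eq_mul_div, one_mul, le_div_iff₀ (by positivity), one_mul]
  exact h

theorem abs_lambdaMin_le {n : ℕ} {f : E n → ℝ} {x₀ x : E n} {κB : ℝ}
    (hB : NegCurvatureBounded f x₀ κB) (hx : f x ≤ f x₀) (hneg : lambdaMin (hess f x) ≤ 0) :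
    |lambdaMin (hess f x)| ≤ κB := by
  rw [abs_of_nonpos hneg]
  exact (le_max_right _ _).trans (hB.2 x hx)

/-- The curvature along the step is at least `-κB`, so `μ ≤ κB / θ` at a negative-curvature step. -/
theorem kappaFO_le_kappaUpNcurv {n : ℕ} {P : Params} {f : E n → ℝ} (hf : ContDiff ℝ 2 f)
    {x₀ x s : E n} {κB σ μ : ℝ} (hB : NegCurvatureBounded f x₀ κB) (hx : f x ≤ f x₀)
    (hmin : P.σmin ≤ σ) (hN : ¬ IsNewton P (gradient f x) σ μ)
    (hs : StepComp P (gradient f x) (hess f x) σ s μ) :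
    kappaFO P (gradient f x) σ μ ≤ kappaUpNcurv P κB := by
  obtain ⟨hμ, -, hs⟩ := hs
  obtain ⟨u, -, -, hu, hcurv, -⟩ := hs hN
  have h1 := lambdaMin_le_inner (inner_hess_comm hf x) hu
  have h2 := (le_max_right _ _).trans (hB.2 x hx)
  have hθ := P.θ_pos
  have hκC := P.one_le_κC
  have hq : 0 < Real.sqrt P.σmin := Real.sqrt_pos.mpr P.σmin_pos
  have hqq : Real.sqrt P.σmin ≤ Real.sqrt σ := Real.sqrt_le_sqrt hmin
  have hB0 := hB.1
  have hμB : μ ≤ κB / P.θ := by rw [le_div_iff₀ hθ]; linarith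
  rw [kappaFO, if_neg hN, kappaUpNcurv]
  have h3 : P.κC * μ / Real.sqrt σ ≤ P.κC * κB / (P.θ * Real.sqrt P.σmin) := by
    calc P.κC * μ / Real.sqrt σ ≤ P.κC * (κB / P.θ) / Real.sqrt P.σmin := by gcongr
      _ = _ := by rw [mul_div_assoc', div_div]
  linarith

theorem progress_negativeCurvature {n : ℕ} {P : Params} {f : E n → ℝ} (hf : ContDiff ℝ 2 f)
    {x₀ x s : E n} {κB σ μ L₀ L₁ δ : ℝ} (hB : NegCurvatureBounded f x₀ κB) (hx : f x ≤ f x₀)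
    (hσ : σ ∈ Set.Icc P.σmin (regBound P L₀ L₁ δ)) (hg : P.ε₁ < ‖gradient f x‖)
    (hN : ¬ IsNewton P (gradient f x) σ μ)
    (hs : StepComp P (gradient f x) (hess f x) σ s μ) (hacc : ¬ FirstOrderRejected P f x σ s μ) :
    1 ≤ weightNcurv P L₀ L₁ δ * (f x - f (x + s)) ∧
      ‖gradient f (x + s)‖ ≤ kappaUpNcurv P κB * (‖gradient f x‖ / P.ε₁) := by
  simp only [FirstOrderRejected, not_or, not_lt] at hacc
  obtain ⟨-, hr, hG⟩ := hacc
  have hθ := P.θ_pos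
  have hκC := P.one_le_κC
  have hε1 := P.ε₁_pos
  have hη1 := P.η₁_pos
  refine ⟨?_, hG.trans ?_⟩
  · obtain ⟨hμ, -, hs⟩ := hs
    obtain ⟨u, rfl, hgu, hu, hcurv, -⟩ := hs hN
    have hσ0 : 0 < σ := P.σmin_pos.trans_le hσ.1
    have hq : 0 < Real.sqrt σ := Real.sqrt_pos.mpr hσ0
    have hqq : Real.sqrt σ ≤ Real.sqrt (regBound P L₀ L₁ δ) := Real.sqrt_le_sqrt hσ.2
    have hq' := hq.trans_le hqq
    have hN' : P.κC * Real.sqrt σ * ‖gradient f x‖ < μ := not_le.mp hN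
    have hD := modelDecrease_smul_ge (c := P.θ * P.κC / Real.sqrt σ) (by positivity) hgu
      (hcurv.trans_eq (neg_mul _ _))
    refine one_le_weight_mul hη1 (by positivity)
      (ratio_mul_le hη1 (by positivity) (le_trans ?_ hD) hr)
    calc P.κC ^ 3 * P.θ ^ 3 * P.ε₁ / (2 * Real.sqrt (regBound P L₀ L₁ δ))
        ≤ P.κC ^ 3 * P.θ ^ 3 * ‖gradient f x‖ / (2 * Real.sqrt σ) := by gcongr
      _ = (P.θ * P.κC / Real.sqrt σ) ^ 2 *
            (P.θ * (P.κC * Real.sqrt σ * ‖gradient f x‖)) / 2 := by field_simp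
      _ ≤ _ := by gcongr
  · gcongr
    exact kappaFO_le_kappaUpNcurv hf hB hx hσ.1 hN hs

/-- An accepted Newton step either is long, and then decreases `f` by a fixed amount, or halves the
gradient. -/
theorem progress_newton {n : ℕ} {P : Params} {f : E n → ℝ} {x s : E n} {σ μ L₀ L₁ δ : ℝ}
    (hσ : σ ∈ Set.Icc P.σmin (regBound P L₀ L₁ δ)) (hg : P.ε₁ < ‖gradient f x‖)
    (hN : IsNewton P (gradient f x) σ μ)
    (hs : StepComp P (gradient f x) (hess f x) σ s μ) (hacc : ¬ FirstOrderRejected P f x σ s μ) :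
    (1 ≤ weightDecr P L₀ L₁ δ * (f x - f (x + s)) ∧
      ‖gradient f (x + s)‖ ≤ kappaUpNewt P * (‖gradient f x‖ / P.ε₁)) ∨
    (f (x + s) ≤ f x ∧ ‖gradient f (x + s)‖ ≤ ‖gradient f x‖ / 2) := by
  simp only [FirstOrderRejected, not_or, not_lt] at hacc
  obtain ⟨hshort, hr, hG⟩ := hacc
  rw [kappaFO, if_pos hN] at hG
  obtain ⟨hμ, hs, -⟩ := hs
  obtain ⟨hcurv, hres, horth⟩ := hs hN
  have hε1 := P.ε₁_pos
  have hη1 := P.η₁_pos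
  have hg0 : 0 < ‖gradient f x‖ := hε1.trans hg
  have hS : 0 < ‖s‖ := norm_pos_iff.mpr (newton_ne_zero hg0 P.κθ_nonneg hres)
  have hq : 0 < Real.sqrt σ := Real.sqrt_pos.mpr (P.σmin_pos.trans_le hσ.1)
  have hqq : Real.sqrt σ ≤ Real.sqrt (regBound P L₀ L₁ δ) := Real.sqrt_le_sqrt hσ.2
  have hq' := hq.trans_le hqq
  have hD := newton_modelDecrease hμ hcurv horth
  have hκ := kappaSlow_pos P
  by_cases hlong : 1 / (Real.sqrt σ * kappaSlow P) ≤ ‖s‖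
  · refine Or.inl ⟨one_le_weight_mul hη1 (by positivity)
      (ratio_mul_le hη1 (by positivity) (le_trans ?_ hD) hr), hG⟩
    calc P.ε₁ / (kappaSlow P ^ 2 * Real.sqrt (regBound P L₀ L₁ δ))
        ≤ ‖gradient f x‖ / (kappaSlow P ^ 2 * Real.sqrt σ) := by gcongr
      _ = Real.sqrt σ * ‖gradient f x‖ * (1 / (Real.sqrt σ * kappaSlow P)) ^ 2 := by field_simp
      _ ≤ _ := by gcongr
  · refine Or.inr ⟨?_, not_lt.mp fun h => hshort ⟨hN, h, not_le.mp hlong⟩⟩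
    have h1 := ratio_mul_le hη1 (by positivity) hD hr
    have h2 : 0 < P.η₁ * (Real.sqrt σ * ‖gradient f x‖ * ‖s‖ ^ 2) := by positivity
    linarith

theorem progress_secondOrder {n : ℕ} {P : Params} {f : E n → ℝ} {x₀ x s : E n}
    {κB σ L₀ L₁ δ G : ℝ} (hB : NegCurvatureBounded f x₀ κB) (hx : f x ≤ f x₀)
    (hσ : σ ∈ Set.Icc P.σmin (regBound P L₀ L₁ δ)) (hneg : lambdaMin (hess f x) < -P.ε₂)
    (hs : SecondOrderStep (gradient f x) (hess f x) σ s)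
    (hacc : ¬ SecondOrderRejected P f x σ s) :
    1 ≤ weightSo P L₀ L₁ δ * (f x - f (x + s)) ∧ ‖gradient f (x + s)‖ ≤ kappaGpi P κB G := by
  simp only [SecondOrderRejected, not_or, not_lt] at hacc
  obtain ⟨hr, hG⟩ := hacc
  have hε2 := P.ε₂_pos
  have hη1 := P.η₁_pos
  have hσ0 : 0 < σ := P.σmin_pos.trans_le hσ.1
  have hσ1 : 0 < regBound P L₀ L₁ δ := hσ0.trans_le hσ.2
  refine ⟨?_, hG.trans (le_max_of_le_right ?_)⟩
  · obtain ⟨u, rfl, hgu, hu, heig⟩ := hs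
    have hcurv : ⟪u, hess f x u⟫ ≤ -P.ε₂ := by
      rw [heig, inner_smul_right, real_inner_self_eq_norm_sq, hu]
      linarith
    have hD := modelDecrease_smul_ge (c := 1 / Real.sqrt σ) (by positivity) hgu hcurv
    refine one_le_weight_mul hη1 (by positivity)
      (ratio_mul_le hη1 (by positivity) (le_trans ?_ hD) hr)
    rw [div_pow, Real.sq_sqrt hσ0.le]
    calc P.ε₂ / (2 * regBound P L₀ L₁ δ) ≤ P.ε₂ / (2 * σ) := by
          gcongr
          exact hσ.2
      _ = _ := by field_simp
  · have hl := abs_lambdaMin_le hB hx (by linarith)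
    have hq : 0 < Real.sqrt P.σmin := Real.sqrt_pos.mpr P.σmin_pos
    have hqq : Real.sqrt P.σmin ≤ Real.sqrt σ := Real.sqrt_le_sqrt hσ.1
    have hη2 : 0 < 1 - P.η₂ := sub_pos.mpr P.η₂_lt_one
    have hB0 := hB.1
    rw [kappaHess]
    gcongr

theorem one_le_kappaUpNewt (P : Params) : 1 ≤ kappaUpNewt P := by
  have h1 := P.η₂_lt_one
  have h2 := P.one_le_κC
  have h3 := P.κθ_nonneg
  rw [kappaUpNewt]
  linarith

theorem one_le_kappaUpNcurv (P : Params) {κB : ℝ} (hB : 0 ≤ κB) : 1 ≤ kappaUpNcurv P κB := by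
  have h1 : 0 < 1 - P.η₂ := sub_pos.mpr P.η₂_lt_one
  have h2 := P.one_le_κC
  have h3 := P.θ_pos
  have h4 : 0 ≤ 3 / 2 * P.θ ^ 2 * P.κC ^ 2 * (1 - P.η₂) := by positivity
  have h5 : 0 ≤ P.κC * κB / (P.θ * Real.sqrt P.σmin) := by positivity
  rw [kappaUpNcurv]
  linarith

theorem one_le_kappaGpi (P : Params) {κB : ℝ} (hB : 0 ≤ κB) (G : ℝ) : 1 ≤ kappaGpi P κB G := by
  have h1 : 0 < 1 - P.η₂ := sub_pos.mpr P.η₂_lt_one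
  have h4 : 0 ≤ 3 * (1 - P.η₂) * κB / (2 * Real.sqrt P.σmin) := by positivity
  have h5 : 0 ≤ κB / Real.sqrt P.σmin := by positivity
  refine le_max_of_le_right ?_
  linarith

/-- The number of successful iterations, with the change of the gradient potential added, is at
most this multiple of the decrease of `f`. -/
noncomputable def progressRate (P : Params) (L₀ L₁ δ κB G : ℝ) : ℝ :=
  weightNcurv P L₀ L₁ δ *
      (1 + (Real.log (kappaUpNcurv P κB) + |Real.log P.ε₁|) / Real.log 2) +
    weightDecr P L₀ L₁ δ * (1 + (Real.log (kappaUpNewt P) + |Real.log P.ε₁|) / Real.log 2) +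
    weightSo P L₀ L₁ δ * (2 + (Real.log (kappaGpi P κB G) + |Real.log P.ε₁|) / Real.log 2)

theorem progressRate_nonneg (P : Params) (L₀ L₁ δ : ℝ) {κB : ℝ} (hB : 0 ≤ κB) (G : ℝ) :
    0 ≤ progressRate P L₀ L₁ δ κB G := by
  have hn := Real.log_nonneg (one_le_kappaUpNcurv P hB)
  have hd := Real.log_nonneg (one_le_kappaUpNewt P)
  have hp := Real.log_nonneg (one_le_kappaGpi P hB G)
  have hl2 := Real.log_pos one_lt_two
  have hwN := weightNcurv_pos P L₀ L₁ δ
  have hwD := weightDecr_pos P L₀ L₁ δ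
  have hwS := weightSo_pos P L₀ L₁ δ
  rw [progressRate]
  positivity

/-- One accepted step pays for itself: it either decreases `f` by an amount that makes up for the
growth of the gradient, or it halves the gradient and so lowers the gradient potential by one. -/
theorem progress_of_accepted {n : ℕ} {P : Params} {f : E n → ℝ} (hf : ContDiff ℝ 2 f)
    {x₀ x s : E n} {κB σ μ L₀ L₁ δ G : ℝ} (hB : NegCurvatureBounded f x₀ κB) (hx : f x ≤ f x₀)
    (hσ : σ ∈ Set.Icc P.σmin (regBound P L₀ L₁ δ)) (hterm : ¬ Terminated P f x)
    (ht : TrialStep P f x σ s μ) (hacc : ¬ Rejected P f x σ s μ) :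
    f (x + s) ≤ f x ∧
    1 + gradPotential P.ε₁ ‖gradient f (x + s)‖ - gradPotential P.ε₁ ‖gradient f x‖ ≤
      progressRate P L₀ L₁ δ κB G * (f x - f (x + s)) := by
  have hε1 := P.ε₁_pos
  have hn := one_le_kappaUpNcurv P hB.1
  have hd := one_le_kappaUpNewt P
  have hp := one_le_kappaGpi P hB.1 G
  have hwN := weightNcurv_pos P L₀ L₁ δ
  have hwD := weightDecr_pos P L₀ L₁ δ
  have hwS := weightSo_pos P L₀ L₁ δ
  have hbN : 0 ≤ (Real.log (kappaUpNcurv P κB) + |Real.log P.ε₁|) / Real.log 2 :=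
    div_nonneg (add_nonneg (Real.log_nonneg hn) (abs_nonneg _)) (Real.log_nonneg one_le_two)
  have hbD : 0 ≤ (Real.log (kappaUpNewt P) + |Real.log P.ε₁|) / Real.log 2 :=
    div_nonneg (add_nonneg (Real.log_nonneg hd) (abs_nonneg _)) (Real.log_nonneg one_le_two)
  have hbS : 0 ≤ (Real.log (kappaGpi P κB G) + |Real.log P.ε₁|) / Real.log 2 :=
    div_nonneg (add_nonneg (Real.log_nonneg hp) (abs_nonneg _)) (Real.log_nonneg one_le_two)
  have hpN := mul_nonneg hwN.le (add_nonneg zero_le_one hbN)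
  have hpD := mul_nonneg hwD.le (add_nonneg zero_le_one hbD)
  have hpS := mul_nonneg hwS.le (add_nonneg zero_le_two hbS)
  have hmul {w b A : ℝ} (hw : 0 < w) (hb : 0 ≤ b) (hA : w * b ≤ A)
      (h : 1 ≤ w * (f x - f (x + s))) :
      f (x + s) ≤ f x ∧ b ≤ A * (f x - f (x + s)) := by
    have h0 : 0 < f x - f (x + s) := pos_of_mul_pos_right (zero_lt_one.trans_le h) hw.le
    refine ⟨by linarith, ?_⟩
    calc b = b * 1 := by ring
      _ ≤ b * (w * (f x - f (x + s))) := by gcongr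
      _ = w * b * (f x - f (x + s)) := by ring
      _ ≤ _ := by gcongr
  rcases lt_or_ge P.ε₁ ‖gradient f x‖ with hg | hg
  · have hacc' : ¬ FirstOrderRejected P f x σ s μ := fun h => hacc (Or.inl ⟨hg, h⟩)
    by_cases hN : IsNewton P (gradient f x) σ μ
    · rcases progress_newton hσ hg hN (ht.1 hg) hacc' with ⟨h1, h2⟩ | ⟨h1, h2⟩
      · have h3 := gradPotential_le_add hε1 P.ε₁_le_one hd h2
        have h4 := hmul (A := progressRate P L₀ L₁ δ κB G) hwD (add_nonneg zero_le_one hbD)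
          (by rw [progressRate]; linarith) h1
        exact ⟨h4.1, by linarith [h4.2]⟩
      · have h3 := gradPotential_add_one_le hε1 hg h2
        have h4 : 0 ≤ progressRate P L₀ L₁ δ κB G * (f x - f (x + s)) :=
          mul_nonneg (progressRate_nonneg P L₀ L₁ δ hB.1 G) (sub_nonneg.mpr h1)
        exact ⟨h1, by linarith⟩
    · obtain ⟨h1, h2⟩ := progress_negativeCurvature hf hB hx hσ hg hN (ht.1 hg) hacc'
      have h3 := gradPotential_le_add hε1 P.ε₁_le_one hn h2
      have h4 := hmul (A := progressRate P L₀ L₁ δ κB G) hwN (add_nonneg zero_le_one hbN)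
        (by rw [progressRate]; linarith) h1
      exact ⟨h4.1, by linarith [h4.2]⟩
  · have hacc' : ¬ SecondOrderRejected P f x σ s := fun h => hacc (Or.inr ⟨hg, h⟩)
    obtain ⟨h1, h2⟩ := progress_secondOrder (G := G) hB hx hσ
      (lambdaMin_lt_of_not_terminated hterm hg) (ht.2 hg) hacc'
    have h3 := gradPotential_le_of_le hε1 P.ε₁_le_one hp h2
    have h3' := gradPotential_nonneg P.ε₁ ‖gradient f x‖
    have h4 := hmul (A := progressRate P L₀ L₁ δ κB G) hwS (add_nonneg zero_le_two hbS)
      (by rw [progressRate]; linarith) h1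
    exact ⟨h4.1, by linarith [h4.2]⟩

/-! ### Counting iterations -/

theorem step_ne_zero {n : ℕ} {P : Params} {f : E n → ℝ} {x s : E n} {σ μ : ℝ} (hσ : 0 < σ)
    (ht : TrialStep P f x σ s μ) : s ≠ 0 := by
  have hq : 0 < Real.sqrt σ := Real.sqrt_pos.mpr hσ
  have hunit {u : E n} (hu : ‖u‖ = 1) : u ≠ 0 := by rintro rfl; simp at hu
  rcases lt_or_ge P.ε₁ ‖gradient f x‖ with hg | hg
  · obtain ⟨-, h1, h2⟩ := ht.1 hg
    by_cases hN : IsNewton P (gradient f x) σ μ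
    · exact newton_ne_zero (P.ε₁_pos.trans hg) P.κθ_nonneg (h1 hN).2.1
    · obtain ⟨u, rfl, -, hu, -⟩ := h2 hN
      have hθ := P.θ_pos
      have hκC := P.one_le_κC
      exact smul_ne_zero (by positivity) (hunit hu)
  · obtain ⟨u, rfl, -, hu, -⟩ := ht.2 hg
    exact smul_ne_zero (by positivity) (hunit hu)

theorem finite_successful {n : ℕ} (x s : ℕ → E n) (K : ℕ) : (successful x s K).Finite :=
  (Set.finite_lt_nat K).subset fun _ h => h.1

theorem ncard_successful_zero {n : ℕ} (x s : ℕ → E n) : (successful x s 0).ncard = 0 := by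
  rw [Set.ncard_eq_zero (finite_successful x s 0)]
  ext j
  simp [successful]

theorem ncard_successful_succ {n : ℕ} {x s : ℕ → E n} {K : ℕ} (h : x (K + 1) = x K + s K) :
    (successful x s (K + 1)).ncard = (successful x s K).ncard + 1 := by
  have : successful x s (K + 1) = insert K (successful x s K) := by
    ext j
    simp only [successful, Set.mem_ofPred_eq, Set.mem_insert_iff]
    constructor
    · rintro ⟨h1, h2⟩
      rcases Nat.lt_succ_iff_lt_or_eq.mp h1 with h3 | h3
      · exact Or.inr ⟨h3, h2⟩
      · exact Or.inl h3
    · rintro (rfl | ⟨h1, h2⟩)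
      · exact ⟨Nat.lt_succ_self _, h⟩
      · exact ⟨h1.trans (Nat.lt_succ_self _), h2⟩
  rw [this, Set.ncard_insert_of_notMem (fun h => lt_irrefl K h.1) (finite_successful x s K)]

theorem ncard_successful_succ_of_ne {n : ℕ} {x s : ℕ → E n} {K : ℕ}
    (h : x (K + 1) ≠ x K + s K) :
    (successful x s (K + 1)).ncard = (successful x s K).ncard := by
  congr 1
  ext j
  simp only [successful, Set.mem_ofPred_eq]
  constructor
  · rintro ⟨h1, h2⟩
    rcases Nat.lt_succ_iff_lt_or_eq.mp h1 with h3 | rfl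
    · exact ⟨h3, h2⟩
    · exact absurd h2 h
  · rintro ⟨h1, h2⟩
    exact ⟨h1.trans (Nat.lt_succ_self _), h2⟩

section Run

variable {n : ℕ} {P : Params} {f : E n → ℝ} {x s : ℕ → E n} {μ σ : ℕ → ℝ}

/-- Trial steps do not vanish, so a rejected iteration does not count as successful. -/
theorem IsRun.ne_of_rejected (hrun : IsRun P f x s μ σ) {k : ℕ}
    (hact : ∀ j ≤ k, ¬ Terminated P f (x j)) (hσ : 0 < σ k)
    (hrej : Rejected P f (x k) (σ k) (s k) (μ k)) : x (k + 1) ≠ x k + s k := by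
  rw [hrun.reject k hact hrej]
  exact fun h => step_ne_zero hσ (hrun.trial k hact) (left_eq_add.mp h)

/-- The progress inequality summed along the run. -/
theorem IsRun.successful_le_progress (hrun : IsRun P f x s μ σ) (hf : ContDiff ℝ 2 f)
    {L₀ L₁ δ κB G : ℝ} (hsm : LocallySmoothHessian f L₀ L₁ δ)
    (hB : NegCurvatureBounded f (x 0) κB) (k : ℕ) (hk : ∀ j < k, ¬ Terminated P f (x j)) :
    f (x k) ≤ f (x 0) ∧
    (successful x s k).ncard + gradPotential P.ε₁ ‖gradient f (x k)‖ ≤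
      gradPotential P.ε₁ ‖gradient f (x 0)‖ +
        progressRate P L₀ L₁ δ κB G * (f (x 0) - f (x k)) := by
  induction k with
  | zero => simp [ncard_successful_zero]
  | succ k ih =>
    have hk' : ∀ j < k, ¬ Terminated P f (x j) := fun j hj => hk j (by omega)
    obtain ⟨h1, h2⟩ := ih hk'
    have hact := active_of_lt hk
    have hσ := hrun.sigma_mem hf hsm k hk'
    by_cases hrej : Rejected P f (x k) (σ k) (s k) (μ k)
    · rw [ncard_successful_succ_of_ne
        (hrun.ne_of_rejected hact (P.σmin_pos.trans_le hσ.1) hrej), hrun.reject k hact hrej]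
      exact ⟨h1, h2⟩
    · have hx := hrun.accept k hact hrej
      obtain ⟨h3, h4⟩ := progress_of_accepted (G := G) hf hB h1 hσ (hact k le_rfl)
        (hrun.trial k hact) hrej
      rw [ncard_successful_succ hx, hx]
      refine ⟨h3.trans h1, ?_⟩
      push_cast
      linarith

/-- Each rejection multiplies the regularization parameter by at least `γ₂`, and each success
divides it by at most `1 / γ₁`. -/
theorem IsRun.le_log_sigma (hrun : IsRun P f x s μ σ) (hf : ContDiff ℝ 2 f)
    {L₀ L₁ δ : ℝ} (hsm : LocallySmoothHessian f L₀ L₁ δ) (k : ℕ)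
    (hk : ∀ j < k, ¬ Terminated P f (x j)) :
    Real.log P.σ₀ + (k - (successful x s k).ncard) * Real.log P.γ₂ -
      (successful x s k).ncard * |Real.log P.γ₁| ≤ Real.log (σ k) := by
  induction k with
  | zero => simp [ncard_successful_zero, hrun.init]
  | succ k ih =>
    have hk' : ∀ j < k, ¬ Terminated P f (x j) := fun j hj => hk j (by omega)
    have h2 := ih hk'
    have hact := active_of_lt hk
    have hσ := hrun.sigma_mem hf hsm k hk'
    have hσ0 := P.σmin_pos.trans_le hσ.1
    have hγ1 := P.γ₁_pos
    have hγ2 := zero_lt_one.trans P.one_lt_γ₂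
    by_cases hrej : Rejected P f (x k) (σ k) (s k) (μ k)
    · rw [ncard_successful_succ_of_ne (hrun.ne_of_rejected hact hσ0 hrej)]
      have h3 := Real.log_le_log (by positivity) (hrun.sigma_unsuccessful k hact hrej).1
      rw [Real.log_mul hγ2.ne' hσ0.ne'] at h3
      push_cast
      linarith
    · rw [ncard_successful_succ (hrun.accept k hact hrej)]
      have h3 : P.γ₁ * σ k ≤ σ (k + 1) := by
        rcases le_or_gt P.η₂ (ratio f (x k) (s k)) with hη | hη
        · exact (le_max_right _ _).trans (hrun.sigma_verySuccessful k hact hrej hη).1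
        · exact (mul_le_of_le_one_left hσ0.le P.γ₁_lt_one.le).trans
            (hrun.sigma_successful k hact hrej hη).1
      have h4 := Real.log_le_log (by positivity) h3
      rw [Real.log_mul hγ1.ne' hσ0.ne'] at h4
      have h5 := neg_abs_le (Real.log P.γ₁)
      push_cast
      linarith

end Run

/-! ### Comparison with the constants of the bound -/

theorem kappaMax2_nonneg (P : Params) (L₀ L₁ δ : ℝ) : 0 ≤ kappaMax2 P L₀ L₁ δ :=
  mul_nonneg P.γ₃_pos.le (le_max_of_le_left (by positivity))

theorem inv_sqrt_pow_three {ε : ℝ} (hε : 0 < ε) : (Real.sqrt ε)⁻¹ ^ 3 = ε ^ (-(3 / 2) : ℝ) := by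
  rw [Real.sqrt_eq_rpow, ← Real.rpow_neg hε.le, ← Real.rpow_natCast, ← Real.rpow_mul hε.le]
  norm_num

theorem inv_pow_three {ε : ℝ} (hε : 0 < ε) : ε⁻¹ ^ 3 = ε ^ (-3 : ℝ) := by
  rw [Real.rpow_neg hε.le, inv_pow]
  norm_cast

theorem max_pow_three_le {a b : ℝ} (ha : 0 ≤ a) (hb : 0 ≤ b) : max a b ^ 3 ≤ a ^ 3 + b ^ 3 := by
  have h1 := pow_nonneg ha 3
  have h2 := pow_nonneg hb 3
  rcases max_cases a b with ⟨h, -⟩ | ⟨h, -⟩ <;> rw [h] <;> linarith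

/-- With `a = ε₁^(-1/2)` and `b = ε₂⁻¹`, the left side is a constant times at most
`max a b * a² ≤ max a b ^ 3 ≤ a³ + b³`. -/
theorem sqrt_regBound_div_le (P : Params) (L₀ L₁ δ : ℝ) :
    Real.sqrt (regBound P L₀ L₁ δ) / P.ε₁ ≤
      Real.sqrt (kappaMax1 P L₀ L₁ δ) *
        max 1 (Real.sqrt (kappaMax2 P L₀ L₁ δ) / Real.sqrt (kappaMax1 P L₀ L₁ δ)) *
        (P.ε₁ ^ (-(3 / 2) : ℝ) + P.ε₂ ^ (-3 : ℝ)) := by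
  have hε1 := P.ε₁_pos
  have hε2 := P.ε₂_pos
  have hk1 : 0 < Real.sqrt (kappaMax1 P L₀ L₁ δ) := Real.sqrt_pos.mpr (kappaMax1_pos P L₀ L₁ δ)
  rw [← inv_sqrt_pow_three hε1, ← inv_pow_three hε2]
  have ha0 : 0 < (Real.sqrt P.ε₁)⁻¹ := inv_pos.mpr (Real.sqrt_pos.mpr hε1)
  have hb0 : 0 < P.ε₂⁻¹ := inv_pos.mpr hε2
  have ha2 : (Real.sqrt P.ε₁)⁻¹ ^ 2 = P.ε₁⁻¹ := by rw [inv_pow, Real.sq_sqrt hε1.le]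
  refine le_trans ?_ (mul_le_mul_of_nonneg_left (max_pow_three_le ha0.le hb0.le) (by positivity))
  set a := (Real.sqrt P.ε₁)⁻¹
  set b := P.ε₂⁻¹ with hb
  set k1 := Real.sqrt (kappaMax1 P L₀ L₁ δ)
  set m := max 1 (Real.sqrt (kappaMax2 P L₀ L₁ δ) / k1)
  have hm1 : 1 ≤ m := le_max_left _ _
  have hm2 : Real.sqrt (kappaMax2 P L₀ L₁ δ) ≤ k1 * m := by
    rw [mul_comm, ← div_le_iff₀ hk1]
    exact le_max_right _ _
  have hsqrt : Real.sqrt (regBound P L₀ L₁ δ) ≤ k1 * m * max a b := by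
    refine Real.sqrt_le_iff.mpr ⟨by positivity, max_le ?_ ?_⟩
    · rw [← ha2, mul_pow]
      gcongr
      · rw [← Real.sq_sqrt (kappaMax1_pos P L₀ L₁ δ).le]
        exact pow_le_pow_left₀ hk1.le (le_mul_of_one_le_right hk1.le hm1) 2
      · exact le_max_left _ _
    · rw [← inv_pow, ← hb, mul_pow]
      gcongr
      · rw [← Real.sq_sqrt (kappaMax2_nonneg P L₀ L₁ δ)]
        gcongr
      · exact le_max_right _ _
  rw [div_eq_mul_inv, ← ha2]
  calc Real.sqrt (regBound P L₀ L₁ δ) * a ^ 2 ≤ k1 * m * max a b * max a b ^ 2 := by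
        gcongr
        exact le_max_left _ _
    _ = _ := by ring

theorem regBound_div_le (P : Params) (L₀ L₁ δ : ℝ) :
    regBound P L₀ L₁ δ / P.ε₂ ≤
      max (kappaMax2 P L₀ L₁ δ) (kappaMax1 P L₀ L₁ δ) *
        (P.ε₁ ^ (-(3 / 2) : ℝ) + P.ε₂ ^ (-3 : ℝ)) := by
  have hε1 := P.ε₁_pos
  have hε2 := P.ε₂_pos
  have hk1 := kappaMax1_pos P L₀ L₁ δ
  have hk : 0 < max (kappaMax2 P L₀ L₁ δ) (kappaMax1 P L₀ L₁ δ) := lt_max_of_lt_right hk1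
  rw [← inv_sqrt_pow_three hε1, ← inv_pow_three hε2]
  have ha0 : 0 < (Real.sqrt P.ε₁)⁻¹ := inv_pos.mpr (Real.sqrt_pos.mpr hε1)
  have hb0 : 0 < P.ε₂⁻¹ := inv_pos.mpr hε2
  have ha2 : (Real.sqrt P.ε₁)⁻¹ ^ 2 = P.ε₁⁻¹ := by rw [inv_pow, Real.sq_sqrt hε1.le]
  refine le_trans ?_ (mul_le_mul_of_nonneg_left (max_pow_three_le ha0.le hb0.le) hk.le)
  set a := (Real.sqrt P.ε₁)⁻¹
  set b := P.ε₂⁻¹ with hb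
  have hreg : regBound P L₀ L₁ δ ≤
      max (kappaMax2 P L₀ L₁ δ) (kappaMax1 P L₀ L₁ δ) * max a b ^ 2 := by
    refine max_le ?_ ?_
    · rw [← ha2]
      gcongr
      · exact le_max_right _ _
      · exact le_max_left _ _
    · rw [← inv_pow, ← hb]
      gcongr
      · exact le_max_left _ _
      · exact le_max_right _ _
  rw [div_eq_mul_inv, ← hb]
  calc regBound P L₀ L₁ δ * b
      ≤ max (kappaMax2 P L₀ L₁ δ) (kappaMax1 P L₀ L₁ δ) * max a b ^ 2 * max a b := by
        gcongr
        exact le_max_right _ _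
    _ = _ := by ring

theorem weightNcurv_mul_le (P : Params) (L₀ L₁ δ : ℝ) {Δ : ℝ} (hΔ : 0 ≤ Δ) :
    weightNcurv P L₀ L₁ δ * Δ ≤
      kappaNcurvHess P L₀ L₁ δ Δ * (P.ε₁ ^ (-(3 / 2) : ℝ) + P.ε₂ ^ (-3 : ℝ)) := by
  have hη1 := P.η₁_pos
  have hκC := P.one_le_κC
  have hθ := P.θ_pos
  calc weightNcurv P L₀ L₁ δ * Δ = 2 * Δ / (P.η₁ * P.κC ^ 3 * P.θ ^ 3) *
        (Real.sqrt (regBound P L₀ L₁ δ) / P.ε₁) := by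
        rw [weightNcurv, ← mul_div_assoc, one_div_div]
        ring
    _ ≤ 2 * Δ / (P.η₁ * P.κC ^ 3 * P.θ ^ 3) * _ :=
        mul_le_mul_of_nonneg_left (sqrt_regBound_div_le P L₀ L₁ δ) (by positivity)
    _ = _ := by rw [kappaNcurvHess, kappaNcurv]; ring

theorem weightDecr_mul_le (P : Params) (L₀ L₁ δ : ℝ) {Δ : ℝ} (hΔ : 0 ≤ Δ) :
    weightDecr P L₀ L₁ δ * Δ ≤
      kappaDecrHess P L₀ L₁ δ Δ * (P.ε₁ ^ (-(3 / 2) : ℝ) + P.ε₂ ^ (-3 : ℝ)) := by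
  have hη1 := P.η₁_pos
  calc weightDecr P L₀ L₁ δ * Δ = Δ * kappaSlow P ^ 2 / P.η₁ *
        (Real.sqrt (regBound P L₀ L₁ δ) / P.ε₁) := by
        rw [weightDecr, ← mul_div_assoc, one_div_div]
        ring
    _ ≤ Δ * kappaSlow P ^ 2 / P.η₁ * _ :=
        mul_le_mul_of_nonneg_left (sqrt_regBound_div_le P L₀ L₁ δ) (by positivity)
    _ = _ := by rw [kappaDecrHess, kappaDecr]; ring

theorem weightSo_mul_le (P : Params) (L₀ L₁ δ : ℝ) {Δ : ℝ} (hΔ : 0 ≤ Δ) :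
    weightSo P L₀ L₁ δ * Δ ≤
      kappaSo P L₀ L₁ δ Δ * (P.ε₁ ^ (-(3 / 2) : ℝ) + P.ε₂ ^ (-3 : ℝ)) := by
  have hη1 := P.η₁_pos
  calc weightSo P L₀ L₁ δ * Δ = 2 * Δ / P.η₁ * (regBound P L₀ L₁ δ / P.ε₂) := by
        rw [weightSo, ← mul_div_assoc, one_div_div]
        ring
    _ ≤ 2 * Δ / P.η₁ * _ :=
        mul_le_mul_of_nonneg_left (regBound_div_le P L₀ L₁ δ) (by positivity)
    _ = _ := by rw [kappaSo]; ring

theorem add_progressRate_mul_le_successBound (P : Params) (L₀ L₁ δ : ℝ) {κB Δ G : ℝ}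
    (hB : 0 ≤ κB) (hΔ : 0 ≤ Δ) :
    gradPotential P.ε₁ G + progressRate P L₀ L₁ δ κB G * Δ ≤
      successBound P L₀ L₁ δ κB Δ G := by
  have hl2 := Real.log_pos one_lt_two
  have hn := Real.log_nonneg (one_le_kappaUpNcurv P hB)
  have hd := Real.log_nonneg (one_le_kappaUpNewt P)
  have hp := Real.log_nonneg (one_le_kappaGpi P hB G)
  have h0 := gradPotential_le_of_le P.ε₁_pos P.ε₁_le_one (one_le_kappaGpi P hB G)
    (le_max_left G _)
  set M := P.ε₁ ^ (-(3 / 2) : ℝ) + P.ε₂ ^ (-3 : ℝ) with hM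
  set bN := (Real.log (kappaUpNcurv P κB) + |Real.log P.ε₁|) / Real.log 2 with hbN
  set bD := (Real.log (kappaUpNewt P) + |Real.log P.ε₁|) / Real.log 2 with hbD
  set bS := (Real.log (kappaGpi P κB G) + |Real.log P.ε₁|) / Real.log 2 with hbS
  have hbN0 : 0 ≤ bN := by positivity
  have hbD0 : 0 ≤ bD := by positivity
  have hbS0 : 0 ≤ bS := by positivity
  calc gradPotential P.ε₁ G + progressRate P L₀ L₁ δ κB G * Δ
      = gradPotential P.ε₁ G + (weightNcurv P L₀ L₁ δ * Δ * (1 + bN) +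
          weightDecr P L₀ L₁ δ * Δ * (1 + bD) + weightSo P L₀ L₁ δ * Δ * (2 + bS)) := by
        rw [progressRate]; ring
    _ ≤ (1 + bS) + (kappaNcurvHess P L₀ L₁ δ Δ * M * (1 + bN) +
          kappaDecrHess P L₀ L₁ δ Δ * M * (1 + bD) + kappaSo P L₀ L₁ δ Δ * M * (2 + bS)) := by
        have hN := weightNcurv_mul_le P L₀ L₁ δ hΔ
        have hD := weightDecr_mul_le P L₀ L₁ δ hΔ
        have hS := weightSo_mul_le P L₀ L₁ δ hΔ
        gcongr
    _ = successBound P L₀ L₁ δ κB Δ G := by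
        rw [successBound, kappaStarHess, kappaStarLog, ← hM, hbN, hbD, hbS]
        ring

/-- Both complexity bounds hold for every initial segment of a run that precedes termination. -/
theorem IsRun.bounds {n : ℕ} {P : Params} {f : E n → ℝ} {x s : ℕ → E n} {μ σ : ℕ → ℝ}
    (hrun : IsRun P f x s μ σ) (hf : ContDiff ℝ 2 f) {f_low : ℝ} (hlow : ∀ y, f_low ≤ f y)
    {L₀ L₁ δ κB : ℝ} (hsm : LocallySmoothHessian f L₀ L₁ δ)
    (hB : NegCurvatureBounded f (x 0) κB) {k : ℕ} (hk : ∀ j < k, ¬ Terminated P f (x j)) :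
    ((successful x s k).ncard : ℝ) ≤
        successBound P L₀ L₁ δ κB (f (x 0) - f_low) ‖gradient f (x 0)‖ ∧
      (k : ℝ) ≤ iterationBound P L₀ L₁ δ κB (f (x 0) - f_low) ‖gradient f (x 0)‖ := by
  have hS : ((successful x s k).ncard : ℝ) ≤
      successBound P L₀ L₁ δ κB (f (x 0) - f_low) ‖gradient f (x 0)‖ := by
    have h1 := (hrun.successful_le_progress (G := ‖gradient f (x 0)‖) hf hsm hB k hk).2
    have h2 := gradPotential_nonneg P.ε₁ ‖gradient f (x k)‖
    have h3 := add_progressRate_mul_le_successBound P L₀ L₁ δ (G := ‖gradient f (x 0)‖) hB.1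
      (sub_nonneg.mpr (hlow (x 0)))
    have h4 : progressRate P L₀ L₁ δ κB ‖gradient f (x 0)‖ * (f (x 0) - f (x k)) ≤
        progressRate P L₀ L₁ δ κB ‖gradient f (x 0)‖ * (f (x 0) - f_low) :=
      mul_le_mul_of_nonneg_left (by linarith [hlow (x k)])
        (progressRate_nonneg P L₀ L₁ δ hB.1 _)
    linarith
  refine ⟨hS, ?_⟩
  have hσ := hrun.sigma_mem hf hsm k hk
  have hσ0 := P.σmin_pos.trans_le hσ.1
  have hγ2 := Real.log_pos P.one_lt_γ₂
  have h1 := hrun.le_log_sigma hf hsm k hk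
  have h2 : Real.log (σ k) - Real.log P.σ₀ ≤ Real.log (max (kappaMax1 P L₀ L₁ δ * P.ε₁⁻¹ / P.σ₀)
      (kappaMax2 P L₀ L₁ δ * (P.ε₂ ^ 2)⁻¹ / P.σ₀)) := by
    rw [← Real.log_div hσ0.ne' P.σ₀_pos.ne', max_div_div_right P.σ₀_pos.le]
    have := P.σ₀_pos
    refine Real.log_le_log (by positivity) ?_
    gcongr
    exact hσ.2
  rw [iterationBound]
  set N := successBound P L₀ L₁ δ κB (f (x 0) - f_low) ‖gradient f (x 0)‖
  set C := Real.log (max (kappaMax1 P L₀ L₁ δ * P.ε₁⁻¹ / P.σ₀)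
      (kappaMax2 P L₀ L₁ δ * (P.ε₂ ^ 2)⁻¹ / P.σ₀))
  set S : ℝ := ((successful x s k).ncard : ℝ)
  have h3 : (k : ℝ) ≤ (1 + |Real.log P.γ₁| / Real.log P.γ₂) * S + 1 / Real.log P.γ₂ * C := by
    refine le_of_mul_le_mul_right ?_ hγ2
    have : ((1 + |Real.log P.γ₁| / Real.log P.γ₂) * S + 1 / Real.log P.γ₂ * C) *
        Real.log P.γ₂ = S * Real.log P.γ₂ + S * |Real.log P.γ₁| + C := by
      field_simp
    rw [this]
    linarith
  refine h3.trans ?_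
  gcongr

end SOAN2CLS

theorem mainTheorem2 {n : ℕ} (hn : 1 ≤ n) (P : SOAN2CLS.Params)
    (f : SOAN2CLS.E n → ℝ) (x s : ℕ → SOAN2CLS.E n) (μ σ : ℕ → ℝ)
    (hrun : SOAN2CLS.IsRun P f x s μ σ)
    (hf : ContDiff ℝ 2 f)
    (f_low : ℝ) (hlow : ∀ y, f_low ≤ f y)
    (L₀ L₁ δ : ℝ) (hsmooth : SOAN2CLS.LocallySmoothHessian f L₀ L₁ δ)
    (κB : ℝ) (hcurv : SOAN2CLS.NegCurvatureBounded f (x 0) κB) :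
    ∃ K : ℕ,
      (‖gradient f (x K)‖ ≤ P.ε₁ ∧ -P.ε₂ ≤ SOAN2CLS.lambdaMin (SOAN2CLS.hess f (x K))) ∧
      (∀ k < K, ¬ SOAN2CLS.Terminated P f (x k)) ∧
      ((SOAN2CLS.successful x s K).ncard : ℝ) ≤
        SOAN2CLS.successBound P L₀ L₁ δ κB (f (x 0) - f_low) ‖gradient f (x 0)‖ ∧
      (K : ℝ) ≤
        SOAN2CLS.iterationBound P L₀ L₁ δ κB (f (x 0) - f_low) ‖gradient f (x 0)‖ := by
  classical
  have hterm : ∃ K, SOAN2CLS.Terminated P f (x K) := by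
    by_contra! h
    obtain ⟨k, hk⟩ := exists_nat_gt
      (SOAN2CLS.iterationBound P L₀ L₁ δ κB (f (x 0) - f_low) ‖gradient f (x 0)‖)
    exact absurd (hrun.bounds hf hlow hsmooth hcurv (k := k) fun j _ => h j).2 (not_le.mpr hk)
  have hmin : ∀ k < Nat.find hterm, ¬ SOAN2CLS.Terminated P f (x k) :=
    fun k hk => Nat.find_min hterm hk
  exact ⟨Nat.find hterm, Nat.find_spec hterm, hmin, hrun.bounds hf hlow hsmooth hcurv hmin⟩
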